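/- Let $\mathbb{T}\subset\mathbb{R}$ be a time scale (a nonempty closed set) with $\sup\mathbb{T}=\infty$, forward jump operator $\sigma(t)=\inf\{s\in\mathbb{T}: s>t\}$ and graininess $\mu(t)=\sigma(t)-t$. Let $A$ be a function on $\mathbb{T}$ with values in the real or complex $n\times n$ matrices which is rd-continuous (continuous at right-dense points, with finite left-sided limits at left-dense points) and regressive ($I+\mu(t)A(t)$ is invertible for all $t\in\mathbb{T}$). Let $a\in\mathbb{T}$, and suppose that the improper delta integral $$\int_a^\infty A(s)\,\Delta s=\lim_{b\to\infty,\ b\in\mathbb{T}}\int_a^b A(s)\,\Delta s$$ converges (possibly only conditionally) and that $$\int_a^\infty A(t)\Big(\int_t^\infty A(s)\,\Delta s\Big)\Delta t$$ converges absolutely, i.e. $\int_a^\infty\big\|A(t)\int_t^\infty A(s)\,\Delta s\big\|\,\Delta t<\infty$. Then the linear dynamic system $$x^\Delta=A(t)x,\qquad t\in\mathbb{T},$$ where $x^\Delta$ denotes the delta derivative, is of class (S): (i) every solution $x(t)$ has a finite limit as $t\to\infty$ in $\mathbb{T}$, and (ii) for every constant vector $c$ there is a solution $x(t)$ on $\mathbb{T}$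 with $x(t)\to c$ as $t\to\infty$. Moreover (equivalently), for every fundamental matrix $X(t)$ of the system, that is, every matrix solution of $X^\Delta=A(t)X$ that is nonsingular at every $t\in\mathbb{T}$, the limit $\lim_{t\to\infty}X(t)$ exists and is nonsingular. -/

import Mathlib

open Filter Topology Set

/-- A time scale: a nonempty closed subset of `ℝ`.  Functions on a time scale `T` are represented by
functions on `ℝ`; every notion below uses only their values at points of `T`. -/
def IsTimeScale (T : Set ℝ) : Prop := T.Nonempty ∧ IsClosed T

open Classical in
/-- The forward jump operator `σ(t) = inf {s ∈ T | s > t}`, with `σ(max T) = max T`. -/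
noncomputable def forwardJump (T : Set ℝ) (t : ℝ) : ℝ :=
  if ∃ s ∈ T, t < s then sInf {s | s ∈ T ∧ t < s} else t

open Classical in
/-- The backward jump operator `ρ(t) = sup {s ∈ T | s < t}`, with `ρ(min T) = min T`. -/
noncomputable def backwardJump (T : Set ℝ) (t : ℝ) : ℝ :=
  if ∃ s ∈ T, s < t then sSup {s | s ∈ T ∧ s < t} else t

/-- The graininess `μ(t) = σ(t) - t`. -/
noncomputable def graininess (T : Set ℝ) (t : ℝ) : ℝ := forwardJump T t - t

/-- `t` is right-dense: `t < sup T` and `σ(t) = t`. -/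
def IsRightDense (T : Set ℝ) (t : ℝ) : Prop := (∃ s ∈ T, t < s) ∧ forwardJump T t = t

/-- `t` is left-dense: `t > inf T` and `ρ(t) = t`. -/
def IsLeftDense (T : Set ℝ) (t : ℝ) : Prop := (∃ s ∈ T, s < t) ∧ backwardJump T t = t

/-- `f` is rd-continuous on `T`: it is continuous at the right-dense points of `T` and has finite
left-sided limits at the left-dense points of `T`. -/
def RdContinuous {E : Type*} [TopologicalSpace E] (T : Set ℝ) (f : ℝ → E) : Prop :=
  ∀ t ∈ T, (IsRightDense T t → ContinuousWithinAt f T t) ∧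
    (IsLeftDense T t → ∃ l : E, Tendsto f (𝓝[T ∩ Iio t] t) (𝓝 l))

/-- `f` has the delta (Hilger) derivative `f'` at `t`: for every `ε > 0`,
`‖f(σ(t)) - f(s) - (σ(t) - s) f'‖ ≤ ε |σ(t) - s|` for all `s ∈ T` near `t`. -/
def HasDeltaDerivAt {E : Type*} [NormedAddCommGroup E] [NormedSpace ℝ E]
    (T : Set ℝ) (f : ℝ → E) (f' : E) (t : ℝ) : Prop :=
  ∀ ε : ℝ, 0 < ε → ∀ᶠ s in 𝓝[T] t,
    ‖f (forwardJump T t) - f s - (forwardJump T t - s) • f'‖ ≤ ε * |forwardJump T t - s|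

/-- `F` is a delta antiderivative of `f` on the time scale `T` (unbounded above, so that the
derivative is meaningful at every point of `T`). -/
def IsDeltaAntideriv {E : Type*} [NormedAddCommGroup E] [NormedSpace ℝ E]
    (T : Set ℝ) (F f : ℝ → E) : Prop :=
  ∀ t ∈ T, HasDeltaDerivAt T F (f t) t

/-- The filter "`t → ∞` along `T`". -/
def atTopIn (T : Set ℝ) : Filter ℝ := atTop ⊓ 𝓟 T

/-- The improper delta integral `∫_a^∞ f(s) Δs` converges (possibly conditionally) to `I`:
`∫_a^b f(s) Δs = F(b) - F(a) → I` as `b → ∞` in `T`, where `F` is an antiderivative of `f`. -/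
def HasImproperDeltaIntegral {E : Type*} [NormedAddCommGroup E] [NormedSpace ℝ E]
    (T : Set ℝ) (f : ℝ → E) (a : ℝ) (I : E) : Prop :=
  ∃ F : ℝ → E, IsDeltaAntideriv T F f ∧ Tendsto (fun b => F b - F a) (atTopIn T) (𝓝 I)

/-- The integral `∫_a^∞ f(s) Δs` converges, possibly only conditionally. -/
def DeltaConvergent {E : Type*} [NormedAddCommGroup E] [NormedSpace ℝ E]
    (T : Set ℝ) (f : ℝ → E) (a : ℝ) : Prop :=
  ∃ I : E, HasImproperDeltaIntegral T f a I

/-- The integral `∫_a^∞ f(s) Δs` converges absolutely: `∫_a^∞ ‖f(s)‖ Δs` converges. -/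
def DeltaAbsConvergent {E : Type*} [NormedAddCommGroup E] [NormedSpace ℝ E]
    (T : Set ℝ) (f : ℝ → E) (a : ℝ) : Prop :=
  DeltaConvergent T (fun s => ‖f s‖) a

open Classical in
/-- The value of `∫_a^∞ f(s) Δs` (and `0` if the integral does not converge). -/
noncomputable def improperDeltaIntegral {E : Type*} [NormedAddCommGroup E] [NormedSpace ℝ E]
    (T : Set ℝ) (f : ℝ → E) (a : ℝ) : E :=
  if h : DeltaConvergent T f a then h.choose else 0

/-
Matrices carry the operator norm induced by the sup norm on vectors.  All norms on this
finite-dimensional space are equivalent, so the notions below do not depend on this choice.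
-/
attribute [local instance] Matrix.linftyOpNormedAddCommGroup Matrix.linftyOpNormedSpace

/-- The matrix function `A` is regressive: `I + μ(t) A(t)` is invertible for every `t ∈ T`. -/
def IsRegressive {𝕜 : Type*} [RCLike 𝕜] {n : ℕ}
    (T : Set ℝ) (A : ℝ → Matrix (Fin n) (Fin n) 𝕜) : Prop :=
  ∀ t ∈ T, IsUnit (1 + graininess T t • A t)

/-- `x` is a solution on `T` of the system `x^Δ = A(t) x`. -/
def IsSolution {𝕜 : Type*} [RCLike 𝕜] {n : ℕ}
    (T : Set ℝ) (A : ℝ → Matrix (Fin n) (Fin n) 𝕜) (x : ℝ → Fin n → 𝕜) : Prop :=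
  ∀ t ∈ T, HasDeltaDerivAt T x (Matrix.mulVec (A t) (x t)) t

/-- `X` is a fundamental matrix of `x^Δ = A(t) x`: a matrix solution, nonsingular on `T`. -/
def IsFundamentalMatrix {𝕜 : Type*} [RCLike 𝕜] {n : ℕ}
    (T : Set ℝ) (A X : ℝ → Matrix (Fin n) (Fin n) 𝕜) : Prop :=
  ∀ t ∈ T, HasDeltaDerivAt T X (A t * X t) t ∧ IsUnit (X t)

/-- The system `x^Δ = A(t) x` is of class (S): every solution has a (finite) limit at `∞`, and every
constant vector is the limit of some solution. -/
def IsClassS {𝕜 : Type*} [RCLike 𝕜] {n : ℕ}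
    (T : Set ℝ) (A : ℝ → Matrix (Fin n) (Fin n) 𝕜) : Prop :=
  (∀ x : ℝ → Fin n → 𝕜, IsSolution T A x →
    ∃ c : Fin n → 𝕜, Tendsto x (atTopIn T) (𝓝 c)) ∧
  (∀ c : Fin n → 𝕜, ∃ x : ℝ → Fin n → 𝕜, IsSolution T A x ∧ Tendsto x (atTopIn T) (𝓝 c))

/-!
A solution `x` is recovered from an invertible solution `Y` of the adjoint system
`Y^Δ = -Y^σ A`: the product rule makes `Y x` constant, so `x = Y⁻¹ c`, and everything reduces to the
claim that `Y` has an invertible limit.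

Put `B(t) = ∫_t^∞ A Δs`, so that `B^Δ = -A` and `B → 0`.  Then `Z = Y (1 - B)` satisfies
`Z^Δ = Y^σ A B`, where `‖A B‖` has a convergent integral and `‖Y‖ ≤ 2 ‖Z‖` as soon as `‖B‖ ≤ 1/2`.
The mean value inequality (`norm_sub_le_of_hasDeltaDerivAt`) bounds `Z` and then gives the Cauchy
criterion, so `Z` and `Y` converge; it also shows that a solution tending to `0` vanishes at some
point (`exists_tendsto_of_adjoint`).  Applied to `V Y` with a constant matrix `V`, this makes the
limit of `Y` invertible (`exists_tendsto_isUnit_of_adjoint`).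

The solutions `X` and `Y` themselves have to be constructed on the whole time scale
(`exists_forall_hasDeltaDerivAt`).  Delta integrals are written as Lebesgue integrals of
`f ∘ lastPoint T`; the dynamic equation becomes an integral equation on `ℝ` with a deviating
argument, whose Picard series converges (`exists_deviating_solution`).  To the left of the initial
point the Picard series needs the equation in the form `x^Δ = A (1 + μ A)⁻¹ x^σ`, which exists by
regressivity.  Constancy of `Y X` then makes `X` and `Y` inverse to each other.
-/

/-! ### The forward jump and the last point of a time scale -/

section Jump

variable {T : Set ℝ}

theorem forwardJump_eq (hu : ∀ t, ∃ s ∈ T, t < s) (t : ℝ) :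
    forwardJump T t = sInf {s | s ∈ T ∧ t < s} := by
  simp only [forwardJump]
  exact if_pos (hu t)

theorem bddBelow_gt (T : Set ℝ) (t : ℝ) : BddBelow {s | s ∈ T ∧ t < s} :=
  ⟨t, fun _ hs => hs.2.le⟩

theorem forwardJump_le (hu : ∀ t, ∃ s ∈ T, t < s) {t r : ℝ} (hr : r ∈ T) (h : t < r) :
    forwardJump T t ≤ r := by
  rw [forwardJump_eq hu]
  exact csInf_le (bddBelow_gt T t) ⟨hr, h⟩

theorem le_forwardJump_of_forall (hu : ∀ t, ∃ s ∈ T, t < s) {t b : ℝ}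
    (h : ∀ r ∈ T, t < r → b ≤ r) : b ≤ forwardJump T t := by
  rw [forwardJump_eq hu]
  exact le_csInf (hu t) fun r hr => h r hr.1 hr.2

theorem le_forwardJump (hu : ∀ t, ∃ s ∈ T, t < s) (t : ℝ) : t ≤ forwardJump T t :=
  le_forwardJump_of_forall hu fun _ _ h => h.le

theorem forwardJump_mem (hc : IsClosed T) (hu : ∀ t, ∃ s ∈ T, t < s) (t : ℝ) :
    forwardJump T t ∈ T := by
  rw [forwardJump_eq hu]
  exact hc.closure_subset_iff.2 (fun _ hs => hs.1) (csInf_mem_closure (hu t) (bddBelow_gt T t))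

theorem forwardJump_mono (hu : ∀ t, ∃ s ∈ T, t < s) : Monotone (forwardJump T) :=
  fun _ _ hab => le_forwardJump_of_forall hu fun _ hr h => forwardJump_le hu hr (hab.trans_lt h)

theorem exists_mem_of_forwardJump_lt (hu : ∀ t, ∃ s ∈ T, t < s) {t b : ℝ}
    (h : forwardJump T t < b) : ∃ r ∈ T, t < r ∧ r < b := by
  rw [forwardJump_eq hu] at h
  obtain ⟨r, hr, hb⟩ := exists_lt_of_csInf_lt (hu t) h
  exact ⟨r, hr.1, hr.2, hb⟩

open Classical in
/-- The last point of `T` at or before the real number `s`, completed by `inf T` to the left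
of `T`, so that it is a monotone map `ℝ → T` for every time scale.  Precomposing with it turns the
delta integral on `T` into a Lebesgue integral on `ℝ`. -/
noncomputable def lastPoint (T : Set ℝ) (s : ℝ) : ℝ :=
  if (T ∩ Iic s).Nonempty then sSup (T ∩ Iic s) else sInf T

theorem bddAbove_inter_Iic (T : Set ℝ) (s : ℝ) : BddAbove (T ∩ Iic s) := ⟨s, fun _ h => h.2⟩

theorem le_lastPoint {r s : ℝ} (hr : r ∈ T) (h : r ≤ s) : r ≤ lastPoint T s := by
  have : (T ∩ Iic s).Nonempty := ⟨r, hr, h⟩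
  simp only [lastPoint, if_pos this]
  exact le_csSup (bddAbove_inter_Iic T s) ⟨hr, h⟩

theorem lastPoint_le {r s : ℝ} (hr : r ∈ T) (h : r ≤ s) : lastPoint T s ≤ s := by
  have : (T ∩ Iic s).Nonempty := ⟨r, hr, h⟩
  simp only [lastPoint, if_pos this]
  exact csSup_le this fun _ h => h.2

theorem lastPoint_self {t : ℝ} (ht : t ∈ T) : lastPoint T t = t :=
  le_antisymm (lastPoint_le ht le_rfl) (le_lastPoint ht le_rfl)

theorem bddBelow_of_inter_Iic_eq_empty {s : ℝ} (h : ¬ (T ∩ Iic s).Nonempty) : BddBelow T :=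
  ⟨s, fun r hr => le_of_lt (not_le.1 fun hrs => h ⟨r, hr, hrs⟩)⟩

theorem lastPoint_mem (hc : IsClosed T) (hne : T.Nonempty) (s : ℝ) : lastPoint T s ∈ T := by
  by_cases h : (T ∩ Iic s).Nonempty
  · simp only [lastPoint, if_pos h]
    exact hc.closure_subset_iff.2 inter_subset_left
      (csSup_mem_closure h (bddAbove_inter_Iic T s))
  · simp only [lastPoint, if_neg h]
    exact hc.csInf_mem hne (bddBelow_of_inter_Iic_eq_empty h)

theorem lastPoint_mono (hc : IsClosed T) (hne : T.Nonempty) : Monotone (lastPoint T) := by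
  intro a b hab
  by_cases h : (T ∩ Iic a).Nonempty
  · obtain ⟨r, hr, hra⟩ := h
    exact le_lastPoint (lastPoint_mem hc hne a) ((lastPoint_le hr hra).trans hab)
  · rw [lastPoint, if_neg h]
    exact csInf_le (bddBelow_of_inter_Iic_eq_empty h) (lastPoint_mem hc hne b)

theorem lastPoint_eq_of_mem_Ico (hc : IsClosed T) (hu : ∀ t, ∃ s ∈ T, t < s) {t s : ℝ}
    (ht : t ∈ T) (hs : s ∈ Ico t (forwardJump T t)) : lastPoint T s = t := by
  refine le_antisymm (not_lt.1 fun h => ?_) (le_lastPoint ht hs.1)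
  have := forwardJump_le hu (lastPoint_mem hc ⟨t, ht⟩ s) h
  exact absurd (this.trans (lastPoint_le ht hs.1)) (not_le.2 hs.2)

theorem le_forwardJump_lastPoint (hu : ∀ t, ∃ s ∈ T, t < s) (s : ℝ) :
    s ≤ forwardJump T (lastPoint T s) :=
  le_forwardJump_of_forall hu fun _ hr h =>
    not_lt.1 fun hrs => absurd (le_lastPoint hr hrs.le) (not_le.2 h)

theorem graininess_nonneg (hu : ∀ t, ∃ s ∈ T, t < s) (t : ℝ) : 0 ≤ graininess T t :=
  sub_nonneg.2 (le_forwardJump hu t)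

theorem lt_forwardJump (hu : ∀ t, ∃ s ∈ T, t < s) {t : ℝ} (h : ¬ IsRightDense T t) :
    t < forwardJump T t :=
  lt_of_le_of_ne (le_forwardJump hu t) fun h' => h ⟨hu t, h'.symm⟩

/-- Near a right-scattered point, the time scale consists of the point and of points to its left. -/
theorem nhdsWithin_le_of_not_isRightDense (hu : ∀ t, ∃ s ∈ T, t < s) {t : ℝ}
    (h : ¬ IsRightDense T t) : 𝓝[T] t ≤ 𝓝[T ∩ Iio t] t ⊔ pure t := by
  have h' := lt_forwardJump hu h
  have h1 : ∀ᶠ s in 𝓝[T] t, s ∈ (T ∩ Iio t) ∪ {t} := by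
    filter_upwards [self_mem_nhdsWithin, nhdsWithin_le_nhds (Iio_mem_nhds h')] with s hs hs'
    rcases lt_trichotomy s t with h1 | h1 | h1
    · exact Or.inl ⟨hs, h1⟩
    · exact Or.inr h1
    · exact absurd (forwardJump_le hu hs h1) (not_le.2 hs')
  rw [← nhdsWithin_singleton, ← nhdsWithin_union]
  exact le_inf nhdsWithin_le_nhds (le_principal_iff.2 h1)

theorem tendsto_graininess_left (hu : ∀ t, ∃ s ∈ T, t < s) {t : ℝ} (ht : t ∈ T) :
    Tendsto (graininess T) (𝓝[T ∩ Iio t] t) (𝓝 0) := by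
  have h1 : Tendsto (fun s => t - s) (𝓝[T ∩ Iio t] t) (𝓝 0) := by
    have : Tendsto (fun s => t - s) (𝓝 t) (𝓝 (t - t)) :=
      (continuous_const.sub continuous_id).tendsto t
    rw [sub_self] at this
    exact this.mono_left nhdsWithin_le_nhds
  refine squeeze_zero' (Eventually.of_forall (graininess_nonneg hu)) ?_ h1
  filter_upwards [self_mem_nhdsWithin] with s hs
  have := forwardJump_le hu ht hs.2
  simp only [graininess]
  linarith

theorem tendsto_graininess (hu : ∀ t, ∃ s ∈ T, t < s) {t : ℝ}
    (h : IsRightDense T t) : Tendsto (graininess T) (𝓝[T] t) (𝓝 0) := by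
  rw [Metric.tendsto_nhds]
  intro ε hε
  obtain ⟨r, hr, htr, hrb⟩ := exists_mem_of_forwardJump_lt hu
    (show forwardJump T t < t + ε / 2 by rw [h.2]; linarith)
  filter_upwards [nhdsWithin_le_nhds (Ioo_mem_nhds (show t - ε / 2 < t by linarith) htr)] with s hs
  have h0 := graininess_nonneg hu s
  have h1 := forwardJump_le hu hr hs.2
  rw [Real.dist_eq, sub_zero, abs_of_nonneg h0, graininess]
  linarith [hs.1]

theorem atTopIn_neBot (hu : ∀ t, ∃ s ∈ T, t < s) : (atTopIn T).NeBot := by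
  rw [atTopIn, ← frequently_mem_iff_neBot, frequently_atTop]
  intro b
  obtain ⟨s, hs, hb⟩ := hu b
  exact ⟨s, hb.le, hs⟩

theorem eventually_atTopIn {p : ℝ → Prop} (t₀ : ℝ) (h : ∀ t ∈ T, t₀ ≤ t → p t) :
    ∀ᶠ t in atTopIn T, p t := by
  filter_upwards [mem_inf_of_left (Ici_mem_atTop t₀), mem_inf_of_right (mem_principal_self T)]
    with t h1 h2 using h t h2 h1

theorem exists_of_eventually_atTopIn (hu : ∀ t, ∃ s ∈ T, t < s) {p : ℝ → Prop}
    (h : ∀ᶠ t in atTopIn T, p t) : ∃ t₀ ∈ T, ∀ t ∈ T, t₀ ≤ t → p t := by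
  rw [atTopIn, eventually_inf_principal, eventually_atTop] at h
  obtain ⟨b, hb⟩ := h
  obtain ⟨s, hs, hbs⟩ := hu b
  exact ⟨s, hs, fun t ht hst => hb t (hbs.le.trans hst) ht⟩

end Jump

/-! ### Calculus of the delta derivative -/

section DeltaDeriv

variable {T : Set ℝ} {E F G : Type*} [NormedAddCommGroup E] [NormedSpace ℝ E]
  [NormedAddCommGroup F] [NormedSpace ℝ F] [NormedAddCommGroup G] [NormedSpace ℝ G]

theorem hasDeltaDerivAt_iff_isLittleO {f : ℝ → E} {f' : E} {t : ℝ} :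
    HasDeltaDerivAt T f f' t ↔
      (fun s => f (forwardJump T t) - f s - (forwardJump T t - s) • f') =o[𝓝[T] t]
        fun s => forwardJump T t - s := by
  simp only [HasDeltaDerivAt, Asymptotics.isLittleO_iff, Real.norm_eq_abs]

/-- The delta derivative at `t` determines the value after the jump, `f(σ(t)) = f(t) + μ(t) f'`
(with no content at right-dense points). -/
theorem HasDeltaDerivAt.forwardJump_eq {f : ℝ → E} {f' : E} {t : ℝ} (ht : t ∈ T)
    (h : HasDeltaDerivAt T f f' t) : f (forwardJump T t) = f t + graininess T t • f' := by
  have key : ‖f (forwardJump T t) - f t - (forwardJump T t - t) • f'‖ ≤ 0 := by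
    refine le_of_forall_pos_le_add fun ε hε => ?_
    have hε' : 0 < ε / (|forwardJump T t - t| + 1) := by positivity
    refine ((h _ hε').self_of_nhdsWithin ht).trans ?_
    rw [zero_add, div_mul_eq_mul_div, div_le_iff₀ (by positivity)]
    nlinarith [abs_nonneg (forwardJump T t - t)]
  have := norm_le_zero_iff.1 key
  rw [graininess, ← sub_eq_zero, ← this]
  abel

theorem HasDeltaDerivAt.continuousWithinAt {f : ℝ → E} {f' : E} {t : ℝ} (ht : t ∈ T)
    (h : HasDeltaDerivAt T f f' t) : ContinuousWithinAt f T t := by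
  have hj := h.forwardJump_eq ht
  have h1 : Tendsto (fun s => f (forwardJump T t) - f s - (forwardJump T t - s) • f')
      (𝓝[T] t) (𝓝 0) := by
    have hb : (fun s : ℝ => forwardJump T t - s) =O[𝓝[T] t] fun _ => (1 : ℝ) := by
      have : Tendsto (fun s : ℝ => forwardJump T t - s) (𝓝[T] t) (𝓝 (forwardJump T t - t)) :=
        (Continuous.tendsto (by fun_prop) t).mono_left nhdsWithin_le_nhds
      exact this.isBigO_one ℝ
    exact (Asymptotics.isLittleO_one_iff ℝ).1 ((hasDeltaDerivAt_iff_isLittleO.1 h).trans_isBigO hb)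
  have h2 : Tendsto (fun s => f (forwardJump T t) - (forwardJump T t - s) • f') (𝓝[T] t)
      (𝓝 (f (forwardJump T t) - (forwardJump T t - t) • f')) :=
    (Continuous.tendsto (by fun_prop) t).mono_left nhdsWithin_le_nhds
  have h3 := h2.sub h1
  rw [ContinuousWithinAt]
  convert h3 using 2
  · abel
  · rw [hj, graininess]; abel

theorem HasDeltaDerivAt.sub {f g : ℝ → E} {f' g' : E} {t : ℝ} (hf : HasDeltaDerivAt T f f' t)
    (hg : HasDeltaDerivAt T g g' t) : HasDeltaDerivAt T (fun s => f s - g s) (f' - g') t := by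
  rw [hasDeltaDerivAt_iff_isLittleO] at *
  refine (hf.sub hg).congr_left fun s => ?_
  rw [smul_sub]; abel

theorem HasDeltaDerivAt.const_sub {f : ℝ → E} {f' : E} {t : ℝ} (c : E)
    (hf : HasDeltaDerivAt T f f' t) : HasDeltaDerivAt T (fun s => c - f s) (-f') t := by
  rw [hasDeltaDerivAt_iff_isLittleO] at *
  refine hf.neg_left.congr_left fun s => ?_
  rw [smul_neg]; abel

theorem HasDeltaDerivAt.const_mul_real {f : ℝ → ℝ} {f' t : ℝ} (c : ℝ)
    (hf : HasDeltaDerivAt T f f' t) : HasDeltaDerivAt T (fun s => c * f s) (c * f') t := by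
  rw [hasDeltaDerivAt_iff_isLittleO] at *
  refine (hf.const_mul_left c).congr_left fun s => ?_
  simp only [smul_eq_mul]; ring

theorem HasDeltaDerivAt.const (c : E) (t : ℝ) : HasDeltaDerivAt T (fun _ => c) (0 : E) t := by
  rw [hasDeltaDerivAt_iff_isLittleO]
  simp

/-- The product rule `(f g)^Δ = f^Δ g + f^σ g^Δ`, for a bounded bilinear product. -/
theorem HasDeltaDerivAt.bilinear {m : E × F → G} (hm : IsBoundedBilinearMap ℝ m)
    {f : ℝ → E} {g : ℝ → F} {f' : E} {g' : F} {t : ℝ} (ht : t ∈ T)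
    (hf : HasDeltaDerivAt T f f' t) (hg : HasDeltaDerivAt T g g' t) :
    HasDeltaDerivAt T (fun s => m (f s, g s)) (m (f', g t) + m (f (forwardJump T t), g')) t := by
  have hgc : Tendsto g (𝓝[T] t) (𝓝 (g t)) := hg.continuousWithinAt ht
  rw [hasDeltaDerivAt_iff_isLittleO] at *
  set σ := forwardJump T t
  obtain ⟨C, hC, hCm⟩ := hm.bound
  have hO : ∀ (u : ℝ → E) (v : ℝ → F), (fun s => m (u s, v s)) =O[𝓝[T] t]
      fun s => ‖u s‖ * ‖v s‖ := fun u v => by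
    refine Asymptotics.IsBigO.of_bound C (Eventually.of_forall fun s => ?_)
    rw [Real.norm_of_nonneg (by positivity), ← mul_assoc]
    exact hCm _ _
  have h1 : (fun s => m (f σ, g σ - g s - (σ - s) • g')) =o[𝓝[T] t] fun s => σ - s := by
    refine (hO (fun _ => f σ) _).trans_isLittleO ?_
    exact hg.norm_left.const_mul_left _
  have h2 : (fun s => m (f σ - f s - (σ - s) • f', g s)) =o[𝓝[T] t] fun s => σ - s := by
    refine (hO _ g).trans_isLittleO ?_
    have := hf.norm_left.mul_isBigO (hgc.norm.isBigO_one ℝ)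
    simpa using this
  have h3 : (fun s => m ((σ - s) • f', g s - g t)) =o[𝓝[T] t] fun s => σ - s := by
    refine (hO _ _).trans_isLittleO ?_
    have e1 : (fun s => ‖(σ - s) • f'‖) =O[𝓝[T] t] fun s => σ - s := by
      refine Asymptotics.IsBigO.of_bound ‖f'‖ (Eventually.of_forall fun s => ?_)
      rw [norm_norm, norm_smul, mul_comm]
    have e2 : (fun s => ‖g s - g t‖) =o[𝓝[T] t] fun _ => (1 : ℝ) := by
      rw [Asymptotics.isLittleO_one_iff]
      simpa using (hgc.sub_const (g t)).norm
    simpa using e1.mul_isLittleO e2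
  refine ((h1.add h2).add h3).congr_left fun s => ?_
  have s1 : ∀ x y z, m (x, y - z) = m (x, y) - m (x, z) := fun x y z => by
    rw [sub_eq_add_neg, ← neg_one_smul ℝ z, hm.add_right, hm.smul_right, neg_one_smul,
      ← sub_eq_add_neg]
  have s2 : ∀ x y z, m (x - y, z) = m (x, z) - m (y, z) := fun x y z => by
    rw [sub_eq_add_neg, ← neg_one_smul ℝ y, hm.add_left, hm.smul_left, neg_one_smul,
      ← sub_eq_add_neg]
  simp only [s1, s2, hm.smul_left, hm.smul_right, smul_add]
  abel

theorem HasDeltaDerivAt.mul {R : Type*} [NormedRing R] [NormedAlgebra ℝ R] {f g : ℝ → R}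
    {f' g' : R} {t : ℝ} (ht : t ∈ T) (hf : HasDeltaDerivAt T f f' t)
    (hg : HasDeltaDerivAt T g g' t) :
    HasDeltaDerivAt T (fun s => f s * g s) (f' * g t + f (forwardJump T t) * g') t :=
  HasDeltaDerivAt.bilinear (m := fun p : R × R => p.1 * p.2)
    (ContinuousLinearMap.mul ℝ R).isBoundedBilinearMap ht hf hg

/-- The mean value inequality: if `‖f^Δ‖ ≤ g^Δ` on `[p, q) ∩ T`, the increment of `f` over `[p, q]`
is bounded by that of `g`. -/
theorem norm_sub_le_of_hasDeltaDerivAt (hc : IsClosed T) (hu : ∀ t, ∃ s ∈ T, t < s)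
    {f f' : ℝ → E} {g g' : ℝ → ℝ} {p q : ℝ} (hp : p ∈ T) (hq : q ∈ T) (hpq : p ≤ q)
    (hf : ∀ t ∈ T, p ≤ t → HasDeltaDerivAt T f (f' t) t)
    (hg : ∀ t ∈ T, p ≤ t → HasDeltaDerivAt T g (g' t) t)
    (hle : ∀ t ∈ T, p ≤ t → t < q → ‖f' t‖ ≤ g' t) : ‖f q - f p‖ ≤ g q - g p := by
  -- Prove the inequality with an extra term `ε (t - p)`, which leaves room at right-dense points.
  have key : ∀ ε : ℝ, 0 < ε → ‖f q - f p‖ ≤ g q - g p + ε * (q - p) := by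
    intro ε hε
    set h : ℝ → ℝ := fun t => ‖f t - f p‖ - (g t - g p) - ε * (t - p) with hh
    have hstep : ∀ t s, ‖f s - f t‖ ≤ g s - g t + ε * (s - t) → h t ≤ 0 → h s ≤ 0 := by
      intro t s h1 h2
      have h3 : ‖f s - f p‖ ≤ ‖f s - f t‖ + ‖f t - f p‖ := norm_sub_le_norm_sub_add_norm_sub _ _ _
      simp only [hh] at h2 ⊢
      linarith
    have hcl : IsClosed ((T ∩ Ici p) ∩ h ⁻¹' Iic 0) := by
      refine ContinuousOn.preimage_isClosed_of_isClosed ?_ (hc.inter isClosed_Ici) isClosed_Iic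
      intro t ht
      have e1 := ((hf t ht.1 ht.2).continuousWithinAt ht.1).mono
        (inter_subset_left : T ∩ Ici p ⊆ T)
      have e2 := ((hg t ht.1 ht.2).continuousWithinAt ht.1).mono
        (inter_subset_left : T ∩ Ici p ⊆ T)
      exact ((e1.sub continuousWithinAt_const).norm.sub (e2.sub continuousWithinAt_const)).sub
        (by fun_prop)
    set U : Set ℝ := {t | t ∈ T ∧ p ≤ t ∧ t ≤ q ∧ ∀ s ∈ T, p ≤ s → s ≤ t → h s ≤ 0} with hU
    have hp0 : h p ≤ 0 := by simp [hh]
    have hpU : p ∈ U := ⟨hp, le_rfl, hpq, fun s _ h1 h2 => le_antisymm h2 h1 ▸ hp0⟩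
    have hUb : BddAbove U := ⟨q, fun t ht => ht.2.2.1⟩
    set c := sSup U with hcdef
    have hcm : c ∈ (T ∩ Ici p) ∩ h ⁻¹' Iic 0 :=
      hcl.closure_subset_iff.2 (fun t ht => ⟨⟨ht.1, ht.2.1⟩, ht.2.2.2 t ht.1 ht.2.1 le_rfl⟩)
        (csSup_mem_closure ⟨p, hpU⟩ hUb)
    have hcT := hcm.1.1
    have hpc : p ≤ c := hcm.1.2
    have hc0 : h c ≤ 0 := hcm.2
    have hcq : c ≤ q := csSup_le ⟨p, hpU⟩ fun t ht => ht.2.2.1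
    have hlow : ∀ s ∈ T, p ≤ s → s ≤ c → h s ≤ 0 := by
      intro s hs hps hsc
      rcases hsc.eq_or_lt with rfl | hlt
      · exact hc0
      · obtain ⟨t, ht, hst⟩ := exists_lt_of_lt_csSup ⟨p, hpU⟩ hlt
        exact ht.2.2.2 s hs hps hst.le
    rcases hcq.eq_or_lt with heq | hlt
    · have := heq ▸ hc0
      simp only [hh] at this
      linarith
    exfalso
    have hfc := hf c hcT hpc
    have hgc := hg c hcT hpc
    have hlec := hle c hcT hpc hlt
    -- A point of `T` after `c` up to which the inequality persists.
    obtain ⟨r, hrT, hcr, hrq, hr⟩ : ∃ r ∈ T, c < r ∧ r ≤ q ∧ ∀ s ∈ T, c < s → s ≤ r → h s ≤ 0 := by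
      by_cases hd : IsRightDense T c
      · have e1 := hfc (ε / 2) (by positivity)
        have e2 := hgc (ε / 2) (by positivity)
        rw [hd.2] at e1 e2
        obtain ⟨δ, hδ, hball⟩ := Metric.mem_nhdsWithin_iff.1 (e1.and e2)
        obtain ⟨r, hrT, hcr, hrb⟩ := exists_mem_of_forwardJump_lt hu
          (show forwardJump T c < min q (c + δ) by
            rw [hd.2]; exact lt_min hlt (by linarith))
        refine ⟨r, hrT, hcr, hrb.le.trans (min_le_left _ _), fun s hs hcs hsr => ?_⟩
        have hsb : s ∈ Metric.ball c δ ∩ T := by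
          refine ⟨?_, hs⟩
          rw [Metric.mem_ball, Real.dist_eq, abs_of_pos (by linarith)]
          linarith [min_le_right q (c + δ)]
        obtain ⟨b1, b2⟩ := hball hsb
        refine hstep c s ?_ hc0
        rw [abs_of_neg (by linarith : c - s < 0)] at b1 b2
        have b3 : ‖f s - f c‖ ≤ ‖f c - f s - (c - s) • f' c‖ + ‖(c - s) • f' c‖ := by
          rw [norm_sub_rev]
          have := norm_add_le (f c - f s - (c - s) • f' c) ((c - s) • f' c)
          simpa using this
        rw [norm_smul, Real.norm_eq_abs, abs_of_neg (by linarith : c - s < 0)] at b3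
        rw [Real.norm_eq_abs, smul_eq_mul] at b2
        have b4 := (abs_le.1 b2).2
        nlinarith
      · have hlt' := lt_forwardJump hu hd
        have hσq := forwardJump_le hu hq hlt
        refine ⟨forwardJump T c, forwardJump_mem hc hu c, hlt', hσq, fun s hs hcs hsr => ?_⟩
        obtain rfl : s = forwardJump T c := le_antisymm hsr (forwardJump_le hu hs hcs)
        refine hstep c _ ?_ hc0
        have j1 := hfc.forwardJump_eq hcT
        have j2 := hgc.forwardJump_eq hcT
        have h0 := graininess_nonneg hu c
        rw [j1, j2, add_sub_cancel_left, add_sub_cancel_left, norm_smul, Real.norm_of_nonneg h0,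
          smul_eq_mul]
        nlinarith
    have hrU : r ∈ U := ⟨hrT, hpc.trans hcr.le, hrq, fun s hs hps hsr =>
      (le_or_gt s c).elim (hlow s hs hps) fun h => hr s hs h hsr⟩
    exact absurd (le_csSup hUb hrU) (not_le.2 hcr)
  refine le_of_forall_pos_le_add fun ε hε => ?_
  refine (key (ε / (q - p + 1)) (div_pos hε (by linarith))).trans ?_
  have : ε / (q - p + 1) * (q - p) ≤ ε := by
    rw [div_mul_eq_mul_div, div_le_iff₀ (by linarith)]
    nlinarith
  linarith

theorem eq_of_hasDeltaDerivAt_zero (hc : IsClosed T) (hu : ∀ t, ∃ s ∈ T, t < s) {f : ℝ → E}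
    (hf : ∀ t ∈ T, HasDeltaDerivAt T f 0 t) {p q : ℝ} (hp : p ∈ T) (hq : q ∈ T) : f p = f q := by
  have key : ∀ p ∈ T, ∀ q ∈ T, p ≤ q → f p = f q := by
    intro p hp q hq hpq
    have := norm_sub_le_of_hasDeltaDerivAt (f' := fun _ => 0) (g := fun _ => (0 : ℝ))
      (g' := fun _ => 0) hc hu hp hq hpq (fun t ht _ => hf t ht)
      (fun t _ _ => HasDeltaDerivAt.const 0 t) (fun _ _ _ _ => by simp)
    rw [sub_self] at this
    exact (sub_eq_zero.1 (norm_le_zero_iff.1 this)).symm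
  rcases le_total p q with h | h
  · exact key p hp q hq h
  · exact (key q hq p hp h).symm

end DeltaDeriv

/-! ### Linear integral equations with deviating argument -/

section Deviating

open MeasureTheory

variable {E : Type*} [NormedAddCommGroup E] [NormedSpace ℝ E]

theorem aestronglyMeasurable_deviating {g : ℝ → E →L[ℝ] E} (hg : AEStronglyMeasurable g volume)
    {τ : ℝ → ℝ} (hτ : Measurable τ) {y : ℝ → E} (hy : Continuous y) :
    AEStronglyMeasurable (fun s => g s (y (τ s))) volume :=
  (ContinuousLinearMap.id ℝ (E →L[ℝ] E)).aestronglyMeasurable_comp₂ hg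
    (hy.comp_aestronglyMeasurable hτ.aestronglyMeasurable)

theorem intervalIntegrable_deviating {g : ℝ → E →L[ℝ] E} (hg : AEStronglyMeasurable g volume)
    {t₀ : ℝ} (hb : ∀ r : ℝ, ∃ K, ∀ s, |s - t₀| ≤ r → ‖g s‖ ≤ K) {τ : ℝ → ℝ} (hτ : Measurable τ)
    (hτ' : ∀ s, |τ s - t₀| ≤ |s - t₀|) {y : ℝ → E} (hy : Continuous y) (a b : ℝ) :
    IntervalIntegrable (fun s => g s (y (τ s))) volume a b := by
  obtain ⟨K, hK⟩ := hb (max |a - t₀| |b - t₀|)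
  obtain ⟨C, hC⟩ := (isCompact_closedBall t₀ (max |a - t₀| |b - t₀|)).exists_bound_of_continuousOn
    hy.continuousOn
  have hm := aestronglyMeasurable_deviating hg hτ hy
  refine (intervalIntegrable_const (c := K * C)).mono_fun hm.restrict ?_
  refine (ae_restrict_iff' measurableSet_uIoc).2 (Eventually.of_forall fun s hs => ?_)
  have hs' : |s - t₀| ≤ max |a - t₀| |b - t₀| := by
    rcases mem_uIoc.1 hs with h | h
    · exact abs_le_max_abs_abs (by linarith) (by linarith)
    · rw [max_comm]; exact abs_le_max_abs_abs (by linarith) (by linarith)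
  have h1 := hK s hs'
  have h2 := hC (τ s) (by rw [Metric.mem_closedBall, Real.dist_eq]; exact (hτ' s).trans hs')
  refine ((g s).le_opNorm_of_le h2).trans ?_
  refine (mul_le_mul_of_nonneg_right h1 ((norm_nonneg _).trans h2)).trans ?_
  exact le_abs_self _

/-- The terms of the Picard series of `x(t) = x₀ + ∫_{t₀}^t g(s) x(τ(s)) ds`, that is, the differences
of consecutive Picard iterates. -/
noncomputable def picardTerm (g : ℝ → E →L[ℝ] E) (τ : ℝ → ℝ) (t₀ : ℝ) (x₀ : E) : ℕ → ℝ → E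
  | 0, _ => x₀
  | k + 1, t => ∫ s in t₀..t, g s (picardTerm g τ t₀ x₀ k (τ s))

theorem continuous_picardTerm {g : ℝ → E →L[ℝ] E} (hg : AEStronglyMeasurable g volume)
    {t₀ : ℝ} (hb : ∀ r : ℝ, ∃ K, ∀ s, |s - t₀| ≤ r → ‖g s‖ ≤ K) {τ : ℝ → ℝ} (hτ : Measurable τ)
    (hτ' : ∀ s, |τ s - t₀| ≤ |s - t₀|) (x₀ : E) (k : ℕ) :
    Continuous (picardTerm g τ t₀ x₀ k) := by
  induction k with
  | zero => exact continuous_const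
  | succ k ih =>
    exact intervalIntegral.continuous_primitive (intervalIntegrable_deviating hg hb hτ hτ' ih) t₀

theorem norm_picardTerm_le {g : ℝ → E →L[ℝ] E} {t₀ r K : ℝ}
    (hK : ∀ s, |s - t₀| ≤ r → ‖g s‖ ≤ K) (hK0 : 0 ≤ K) {τ : ℝ → ℝ}
    (hτ' : ∀ s, |τ s - t₀| ≤ |s - t₀|) (x₀ : E) (k : ℕ) (t : ℝ) (ht : |t - t₀| ≤ r) :
    ‖picardTerm g τ t₀ x₀ k t‖ ≤ ‖x₀‖ * ((K * |t - t₀|) ^ k / k.factorial) := by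
  induction k generalizing t with
  | zero => simp [picardTerm]
  | succ k ih =>
    set c : ℝ := ‖x₀‖ * K ^ (k + 1) / k.factorial with hc
    have hbd : ∀ s ∈ uIoc t₀ t, ‖g s (picardTerm g τ t₀ x₀ k (τ s))‖ ≤ c * |s - t₀| ^ k := by
      intro s hs
      have hst : |s - t₀| ≤ |t - t₀| := by
        rcases mem_uIoc.1 hs with h | h
        · rw [abs_of_nonneg (by linarith), abs_of_nonneg (by linarith)]; linarith
        · rw [abs_of_nonpos (by linarith), abs_of_nonpos (by linarith)]; linarith
      have h1 := hK s (hst.trans ht)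
      have h2 := ih (τ s) ((hτ' s).trans (hst.trans ht))
      calc ‖g s (picardTerm g τ t₀ x₀ k (τ s))‖
          ≤ ‖g s‖ * ‖picardTerm g τ t₀ x₀ k (τ s)‖ := (g s).le_opNorm _
        _ ≤ K * (‖x₀‖ * ((K * |s - t₀|) ^ k / k.factorial)) := by
            refine mul_le_mul h1 (h2.trans ?_) (norm_nonneg _) hK0
            have h3 := mul_le_mul_of_nonneg_left (hτ' s) hK0
            gcongr
        _ = c * |s - t₀| ^ k := by rw [hc, mul_pow, pow_succ]; ring
    have hint : IntegrableOn (fun s => c * |s - t₀| ^ k) (uIoc t₀ t) :=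
      ((by fun_prop : Continuous fun s => c * |s - t₀| ^ k).integrableOn_uIcc).mono_set
        uIoc_subset_uIcc
    rw [picardTerm, intervalIntegral.norm_integral_eq_norm_integral_uIoc]
    refine (norm_integral_le_of_norm_le hint
      ((ae_restrict_iff' measurableSet_uIoc).2 (Eventually.of_forall hbd))).trans_eq ?_
    rw [integral_const_mul, integral_pow_abs_sub_uIoc, hc, Nat.factorial_succ, mul_pow]
    push_cast
    field_simp

/-- A linear integral equation whose argument `τ(s)` never deviates farther from the starting point
`t₀` than `s` has a continuous solution on the whole line, the sum of its Picard series.  Since only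
the distance to `t₀` matters, one statement covers both directions of time. -/
theorem exists_deviating_solution [CompleteSpace E] {g : ℝ → E →L[ℝ] E}
    (hg : AEStronglyMeasurable g volume) {t₀ : ℝ}
    (hb : ∀ r : ℝ, ∃ K, ∀ s, |s - t₀| ≤ r → ‖g s‖ ≤ K) {τ : ℝ → ℝ} (hτ : Measurable τ)
    (hτ' : ∀ s, |τ s - t₀| ≤ |s - t₀|) (x₀ : E) :
    ∃ x : ℝ → E, Continuous x ∧ ∀ t, x t = x₀ + ∫ s in t₀..t, g s (x (τ s)) := by
  set u := picardTerm g τ t₀ x₀ with hu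
  have hK : ∀ r : ℝ, ∃ K, 0 ≤ K ∧ ∀ s, |s - t₀| ≤ r → ‖g s‖ ≤ K := fun r => by
    obtain ⟨K, hK⟩ := hb r
    exact ⟨max K 0, le_max_right _ _, fun s hs => (hK s hs).trans (le_max_left _ _)⟩
  have hsm : ∀ K r : ℝ, Summable fun k : ℕ => ‖x₀‖ * ((K * r) ^ k / k.factorial) := fun K r =>
    (Real.summable_pow_div_factorial (K * r)).mul_left _
  have hle : ∀ {r K : ℝ}, 0 ≤ K → (∀ s, |s - t₀| ≤ r → ‖g s‖ ≤ K) → ∀ k t, |t - t₀| ≤ r →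
      ‖u k t‖ ≤ ‖x₀‖ * ((K * r) ^ k / k.factorial) := by
    intro r K hK0 hKr k t ht
    refine (norm_picardTerm_le hKr hK0 hτ' x₀ k t ht).trans ?_
    gcongr
  have hsum : ∀ t, Summable fun k => u k t := fun t => by
    obtain ⟨K, hK0, hKr⟩ := hK |t - t₀|
    exact Summable.of_norm_bounded (hsm K |t - t₀|) fun k => hle hK0 hKr k t le_rfl
  refine ⟨fun t => ∑' k, u k t, ?_, fun t => ?_⟩
  · rw [continuous_iff_continuousAt]
    intro t
    obtain ⟨K, hK0, hKr⟩ := hK (|t - t₀| + 1)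
    have hcont : ContinuousOn (fun t => ∑' k, u k t) (Metric.closedBall t₀ (|t - t₀| + 1)) := by
      refine continuousOn_tsum (fun k => (continuous_picardTerm hg hb hτ hτ' x₀ k).continuousOn)
        (hsm K (|t - t₀| + 1)) fun k s hs => hle hK0 hKr k s ?_
      rwa [Metric.mem_closedBall, Real.dist_eq] at hs
    refine hcont.continuousAt (mem_of_superset (Metric.isOpen_ball.mem_nhds ?_)
      Metric.ball_subset_closedBall)
    rw [Metric.mem_ball, Real.dist_eq]
    linarith
  · obtain ⟨K, hK0, hKr⟩ := hK |t - t₀|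
    have hst : ∀ s ∈ uIoc t₀ t, |s - t₀| ≤ |t - t₀| := fun s hs => by
      rcases mem_uIoc.1 hs with h | h
      · rw [abs_of_nonneg (by linarith), abs_of_nonneg (by linarith)]; linarith
      · rw [abs_of_nonpos (by linarith), abs_of_nonpos (by linarith)]; linarith
    have hI : HasSum (fun k => ∫ s in t₀..t, g s (u k (τ s)))
        (∫ s in t₀..t, g s (∑' k, u k (τ s))) := by
      refine intervalIntegral.hasSum_integral_of_dominated_convergence
        (fun k _ => K * (‖x₀‖ * ((K * |t - t₀|) ^ k / k.factorial))) (fun k => ?_) (fun k => ?_)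
        ?_ ?_ ?_
      · exact (aestronglyMeasurable_deviating hg hτ
          (continuous_picardTerm hg hb hτ hτ' x₀ k)).restrict
      · refine Eventually.of_forall fun s hs => ((g s).le_opNorm _).trans ?_
        exact mul_le_mul (hKr s (hst s hs)) (hle hK0 hKr k _ ((hτ' s).trans (hst s hs)))
          (norm_nonneg _) hK0
      · exact Eventually.of_forall fun s _ => (hsm K |t - t₀|).mul_left K
      · exact intervalIntegrable_const
      · exact Eventually.of_forall fun s _ => (hsum (τ s)).hasSum.mapL (g s)
    have h0 := (hsum t).tsum_eq_zero_add
    beta_reduce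
    rw [h0, ← hI.tsum_eq]
    rfl

end Deviating

/-! ### Coefficients and the existence of solutions on the whole time scale -/

section Coefficients

open MeasureTheory

variable {T : Set ℝ} {E : Type*} [NormedAddCommGroup E]

/-- Continuity at right-dense points and local boundedness on `T`.  It follows from rd-continuity,
suffices for delta integration, and is inherited by the coefficients of the backward and adjoint
equations without any discussion of left-sided limits. -/
def RdBounded (T : Set ℝ) (f : ℝ → E) : Prop :=
  ∀ t ∈ T, (IsRightDense T t → ContinuousWithinAt f T t) ∧ ∃ C, ∀ᶠ s in 𝓝[T] t, ‖f s‖ ≤ C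

theorem exists_bound_of_tendsto {l : Filter ℝ} {f : ℝ → E} {c : E} (h : Tendsto f l (𝓝 c)) :
    ∃ C, ∀ᶠ s in l, ‖f s‖ ≤ C :=
  ⟨‖c‖ + 1, h.norm.eventually_le_const (lt_add_one _)⟩

theorem exists_bound_sup_pure {l : Filter ℝ} {f : ℝ → E} {t : ℝ}
    (h : ∃ C, ∀ᶠ s in l, ‖f s‖ ≤ C) : ∃ C, ∀ᶠ s in l ⊔ pure t, ‖f s‖ ≤ C := by
  obtain ⟨C, hC⟩ := h
  refine ⟨max C ‖f t‖, eventually_sup.2 ⟨hC.mono fun s hs => hs.trans (le_max_left _ _), ?_⟩⟩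
  exact eventually_pure.2 (le_max_right C ‖f t‖)

theorem RdContinuous.rdBounded (hu : ∀ t, ∃ s ∈ T, t < s) {f : ℝ → E} (hf : RdContinuous T f) :
    RdBounded T f := by
  intro t ht
  refine ⟨(hf t ht).1, ?_⟩
  by_cases hd : IsRightDense T t
  · exact exists_bound_of_tendsto ((hf t ht).1 hd)
  · have key : ∃ C, ∀ᶠ s in 𝓝[T ∩ Iio t] t, ‖f s‖ ≤ C := by
      by_cases hl : IsLeftDense T t
      · obtain ⟨l, hl'⟩ := (hf t ht).2 hl
        exact exists_bound_of_tendsto hl'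
      · have hbot : 𝓝[T ∩ Iio t] t = ⊥ := by
          by_cases he : ∃ s ∈ T, s < t
          · have hρ : backwardJump T t ≠ t := fun h => hl ⟨he, h⟩
            have hρ' : backwardJump T t = sSup {s | s ∈ T ∧ s < t} := by
              simp only [backwardJump]
              exact if_pos he
            have hb : BddAbove {s | s ∈ T ∧ s < t} := ⟨t, fun s hs => hs.2.le⟩
            have hlt : backwardJump T t < t :=
              lt_of_le_of_ne (hρ' ▸ csSup_le he fun s hs => hs.2.le) hρ
            rw [← empty_mem_iff_bot]
            filter_upwards [self_mem_nhdsWithin, nhdsWithin_le_nhds (Ioi_mem_nhds hlt)] with s hs hs'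
            exact absurd (hρ' ▸ le_csSup hb hs : s ≤ backwardJump T t) (not_le.2 hs')
          · have : T ∩ Iio t = ∅ := eq_empty_iff_forall_notMem.2 fun s hs => he ⟨s, hs.1, hs.2⟩
            rw [this, nhdsWithin_empty]
        exact ⟨0, by simp [hbot]⟩
    obtain ⟨C, hC⟩ := exists_bound_sup_pure (t := t) key
    exact ⟨C, hC.filter_mono (nhdsWithin_le_of_not_isRightDense hu hd)⟩

theorem RdBounded.exists_bound (hc : IsClosed T) {f : ℝ → E} (hf : RdBounded T f) (a b : ℝ) :
    ∃ C, ∀ s ∈ T ∩ Icc a b, ‖f s‖ ≤ C := by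
  refine (isCompact_Icc.inter_left hc).induction_on
    (p := fun S => ∃ C, ∀ s ∈ S, ‖f s‖ ≤ C) ⟨0, by simp⟩ ?_ ?_ ?_
  · rintro S S' h ⟨C, hC⟩
    exact ⟨C, fun s hs => hC s (h hs)⟩
  · rintro S S' ⟨C, hC⟩ ⟨C', hC'⟩
    exact ⟨max C C', fun s hs => hs.elim (fun h => (hC s h).trans (le_max_left _ _))
      fun h => (hC' s h).trans (le_max_right _ _)⟩
  · intro t ht
    obtain ⟨C, hC⟩ := (hf t ht.1).2
    exact ⟨_, nhdsWithin_mono t inter_subset_left hC, C, fun s hs => hs⟩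

/-- The extension `f ∘ lastPoint T` of `f` is continuous off the countable set of scattered
points. -/
theorem RdBounded.aestronglyMeasurable (hc : IsClosed T) (hne : T.Nonempty)
    (hu : ∀ t, ∃ s ∈ T, t < s) {f : ℝ → E} (hf : RdBounded T f) :
    AEStronglyMeasurable (fun s => f (lastPoint T s)) volume := by
  set D := {s | ¬ ContinuousAt (lastPoint T) s} ∪ {s | ¬ ContinuousAt (forwardJump T) s} with hD
  have hDc : D.Countable := (lastPoint_mono hc hne).countable_not_continuousAt.union
    (forwardJump_mono hu).countable_not_continuousAt
  have hcont : ContinuousOn (fun s => f (lastPoint T s)) Dᶜ := by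
    intro s hs
    simp only [hD, mem_compl_iff, mem_union, mem_ofPred_eq, not_or, not_not] at hs
    refine ContinuousAt.continuousWithinAt ?_
    by_cases hsT : s ∈ T
    · have hπ : Tendsto (lastPoint T) (𝓝 s) (𝓝[T] s) := by
        refine tendsto_nhdsWithin_iff.2 ⟨?_, Eventually.of_forall (lastPoint_mem hc hne)⟩
        have := hs.1.tendsto
        rwa [lastPoint_self hsT] at this
      by_cases hd : IsRightDense T s
      · have h1 : Tendsto f (𝓝[T] s) (𝓝 (f s)) := (hf s hsT).1 hd
        have h2 := h1.comp hπ
        rw [ContinuousAt, lastPoint_self hsT]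
        exact h2
      · -- `σ` is continuous at `s` and exceeds `s`, so `T` does not accumulate at `s` from the left.
        have hbot : 𝓝[T ∩ Iio s] s = ⊥ := by
          by_contra hne'
          have : (𝓝[T ∩ Iio s] s).NeBot := ⟨hne'⟩
          refine absurd (le_of_tendsto (hs.2.tendsto.mono_left nhdsWithin_le_nhds)
            (?_ : ∀ᶠ r in 𝓝[T ∩ Iio s] s, forwardJump T r ≤ s))
            (not_le.2 (lt_forwardJump hu hd))
          filter_upwards [self_mem_nhdsWithin] with r hr using forwardJump_le hu hsT hr.2
        have hπ' := hπ.mono_right (nhdsWithin_le_of_not_isRightDense hu hd)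
        rw [hbot, bot_sup_eq, tendsto_pure] at hπ'
        refine continuousAt_const.congr (f := fun _ => f s) ?_
        filter_upwards [hπ'] with r hr
        rw [hr]
    · obtain ⟨δ, hδ, hball⟩ := Metric.isOpen_iff.1 hc.isOpen_compl s hsT
      refine continuousAt_const.congr (f := fun _ => f (lastPoint T s)) ?_
      filter_upwards [Metric.ball_mem_nhds s hδ] with r hr
      have hset : T ∩ Iic r = T ∩ Iic s := by
        rw [Metric.mem_ball, Real.dist_eq, abs_lt] at hr
        ext w
        refine and_congr_right fun hw => ?_
        have hw' : ¬ |w - s| < δ := fun h => hball (by rwa [Metric.mem_ball, Real.dist_eq]) hw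
        rw [abs_lt, not_and_or, not_lt, not_lt] at hw'
        simp only [mem_Iic]
        rcases hw' with h | h <;> constructor <;> intro <;> linarith
      rw [lastPoint, lastPoint, hset]
  have h0 : volume.restrict Dᶜ = (volume : Measure ℝ) :=
    Measure.restrict_eq_self_of_ae_mem (hDc.ae_notMem volume)
  rw [← h0]
  exact hcont.aestronglyMeasurable hDc.measurableSet.compl

theorem RdBounded.exists_bound_comp (hc : IsClosed T) (hne : T.Nonempty) {f : ℝ → E}
    (hf : RdBounded T f) (a b : ℝ) : ∃ C, ∀ s ∈ Icc a b, ‖f (lastPoint T s)‖ ≤ C := by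
  obtain ⟨C, hC⟩ := hf.exists_bound hc (lastPoint T a) (lastPoint T b)
  exact ⟨C, fun s hs => hC _ ⟨lastPoint_mem hc hne s, lastPoint_mono hc hne hs.1,
    lastPoint_mono hc hne hs.2⟩⟩

theorem RdBounded.intervalIntegrable (hc : IsClosed T) (hne : T.Nonempty)
    (hu : ∀ t, ∃ s ∈ T, t < s) {f : ℝ → E} (hf : RdBounded T f) (a b : ℝ) :
    IntervalIntegrable (fun s => f (lastPoint T s)) volume a b := by
  obtain ⟨C, hC⟩ := hf.exists_bound_comp hc hne (min a b) (max a b)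
  refine (intervalIntegrable_const (c := C)).mono_fun
    (hf.aestronglyMeasurable hc hne hu).restrict ?_
  refine (ae_restrict_iff' measurableSet_uIoc).2 (Eventually.of_forall fun s hs => ?_)
  exact (hC s ⟨hs.1.le, hs.2⟩).trans (le_abs_self C)

variable [NormedSpace ℝ E]

theorem integral_congr_of_Ioo {f g : ℝ → E} {a b : ℝ} (hab : a ≤ b)
    (h : ∀ r ∈ Ioo a b, f r = g r) : ∫ r in a..b, f r = ∫ r in a..b, g r :=
  intervalIntegral.integral_congr_uIoo fun r hr => h r (by rwa [uIoo_of_le hab] at hr)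

/-- The fundamental theorem of calculus on `T`, with the delta integral written as the Lebesgue
integral of `f ∘ lastPoint T`. -/
theorem RdBounded.hasDeltaDerivAt (hc : IsClosed T) (hu : ∀ t, ∃ s ∈ T, t < s) [CompleteSpace E]
    {f F : ℝ → E} (hf : RdBounded T f)
    (hF : ∀ p ∈ T, ∀ q ∈ T, p ≤ q → F q - F p = ∫ r in p..q, f (lastPoint T r)) {t : ℝ}
    (ht : t ∈ T) : HasDeltaDerivAt T F (f t) t := by
  have hne : T.Nonempty := ⟨t, ht⟩
  have hint := hf.intervalIntegrable hc hne hu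
  have hF' : ∀ p ∈ T, ∀ q ∈ T, F q - F p = ∫ r in p..q, f (lastPoint T r) := by
    intro p hp q hq
    rcases le_total p q with h | h
    · exact hF p hp q hq h
    · rw [intervalIntegral.integral_symm, ← hF q hq p hp h, neg_sub]
  intro ε hε
  by_cases hd : IsRightDense T t
  · rw [hd.2]
    obtain ⟨δ, hδ, hball⟩ := Metric.mem_nhdsWithin_iff.1
      (Metric.tendsto_nhds.1 ((hf t ht).1 hd) ε hε)
    filter_upwards [self_mem_nhdsWithin, nhdsWithin_le_nhds (Metric.ball_mem_nhds t hδ)] with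
      s hs hsb
    rw [hF' s hs t ht, ← intervalIntegral.integral_const, ← intervalIntegral.integral_sub
      (hint s t) intervalIntegrable_const]
    refine intervalIntegral.norm_integral_le_of_norm_le_const fun r hr => ?_
    rw [← dist_eq_norm]
    refine le_of_lt (hball ⟨?_, lastPoint_mem hc hne r⟩)
    rw [Metric.mem_ball, Real.dist_eq, abs_lt] at hsb ⊢
    rcases mem_uIoc.1 hr with h | h
    · have h1 := le_lastPoint hs h.1.le
      have h2 := lastPoint_le hs h.1.le
      constructor <;> linarith [h.2]
    · have h1 := le_lastPoint ht h.1.le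
      have h2 := lastPoint_le ht h.1.le
      constructor <;> linarith [h.2]
  · have hlt := lt_forwardJump hu hd
    set σ := forwardJump T t with hσ
    have hjump : F σ - F t = (σ - t) • f t := by
      rw [hF t ht σ (forwardJump_mem hc hu t) hlt.le, ← intervalIntegral.integral_const]
      refine integral_congr_of_Ioo hlt.le fun r hr => ?_
      simp only [lastPoint_eq_of_mem_Ico hc hu ht (Ioo_subset_Ico_self hr)]
    have hcont : Tendsto (fun s => (∫ r in s..t, f (lastPoint T r)) - (t - s) • f t) (𝓝[T] t)
        (𝓝 0) := by
      have h1 : Continuous fun s => (-∫ r in t..s, f (lastPoint T r)) - (t - s) • f t :=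
        (intervalIntegral.continuous_primitive hint t).neg.sub (by fun_prop)
      have h2 := h1.tendsto t
      simp only [intervalIntegral.integral_same, neg_zero, sub_self, zero_smul] at h2
      refine (h2.mono_left nhdsWithin_le_nhds).congr fun s => ?_
      rw [intervalIntegral.integral_symm, neg_neg]
    have hpos : 0 < ε * ((σ - t) / 2) := by
      have : 0 < σ - t := sub_pos.2 hlt
      positivity
    filter_upwards [self_mem_nhdsWithin, Metric.tendsto_nhds.1 hcont _ hpos,
      nhdsWithin_le_nhds (Iio_mem_nhds (show t < t + (σ - t) / 2 by linarith))] with s hs h1 h2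
    rw [dist_zero_right, ← hF' s hs t ht] at h1
    have h3 : F σ - F s - (σ - s) • f t = F t - F s - (t - s) • f t := by
      have e1 : F σ = F t + (σ - t) • f t := by rw [← hjump]; abel
      rw [e1, sub_smul, sub_smul, sub_smul]
      abel
    rw [h3]
    refine h1.le.trans (mul_le_mul_of_nonneg_left ?_ hε.le)
    have h4 : s < t + (σ - t) / 2 := h2
    exact le_trans (by linarith) (le_abs_self _)

/-- Existence on all of `T` of a solution of `x^Δ = P(t) x` with a given value at `t₀ ∈ T`.  To the
left of `t₀` the equation is solved in its backward form `x^Δ = Q(t) x^σ`, which the relation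
`P (1 - μ Q) = Q` makes equivalent; this is where regressivity enters. -/
theorem exists_forall_hasDeltaDerivAt (hc : IsClosed T) (hu : ∀ t, ∃ s ∈ T, t < s)
    [CompleteSpace E] {P Q : ℝ → E →L[ℝ] E} (hP : RdBounded T P) (hQ : RdBounded T Q)
    (hPQ : ∀ t ∈ T, ∀ v, P t (v - graininess T t • Q t v) = Q t v) {t₀ : ℝ} (ht₀ : t₀ ∈ T)
    (x₀ : E) : ∃ x : ℝ → E, x t₀ = x₀ ∧ ∀ t ∈ T, HasDeltaDerivAt T x (P t (x t)) t := by
  have hne : T.Nonempty := ⟨t₀, ht₀⟩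
  have hπm := lastPoint_mono hc hne
  set g : ℝ → E →L[ℝ] E := (Ici t₀).piecewise (fun s => P (lastPoint T s))
    (fun s => Q (lastPoint T s)) with hg
  set τ : ℝ → ℝ := (Ici t₀).piecewise (lastPoint T)
    (fun s => min t₀ (forwardJump T (lastPoint T s))) with hτ
  have hgr : ∀ {s}, t₀ ≤ s → g s = P (lastPoint T s) := fun h => piecewise_eq_of_mem _ _ _ h
  have hgl : ∀ {s}, s < t₀ → g s = Q (lastPoint T s) := fun h =>
    piecewise_eq_of_notMem _ _ _ (not_le.2 h)
  have hτr : ∀ {s}, t₀ ≤ s → τ s = lastPoint T s := fun h => piecewise_eq_of_mem _ _ _ h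
  have hτl : ∀ {s}, s < t₀ → τ s = min t₀ (forwardJump T (lastPoint T s)) := fun h =>
    piecewise_eq_of_notMem _ _ _ (not_le.2 h)
  have hgm : AEStronglyMeasurable g volume :=
    AEStronglyMeasurable.piecewise measurableSet_Ici (hP.aestronglyMeasurable hc hne hu).restrict
      (hQ.aestronglyMeasurable hc hne hu).restrict
  have hgb : ∀ r : ℝ, ∃ K, ∀ s, |s - t₀| ≤ r → ‖g s‖ ≤ K := by
    intro r
    obtain ⟨C, hC⟩ := hP.exists_bound_comp hc hne (t₀ - r) (t₀ + r)
    obtain ⟨C', hC'⟩ := hQ.exists_bound_comp hc hne (t₀ - r) (t₀ + r)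
    refine ⟨max C C', fun s hs => ?_⟩
    have hs' : s ∈ Icc (t₀ - r) (t₀ + r) := by
      rw [abs_le] at hs; constructor <;> linarith [hs.1, hs.2]
    rcases le_or_gt t₀ s with h | h
    · rw [hgr h]; exact (hC s hs').trans (le_max_left _ _)
    · rw [hgl h]; exact (hC' s hs').trans (le_max_right _ _)
  have hτm : Measurable τ := Measurable.piecewise measurableSet_Ici hπm.measurable
    (measurable_const.min ((forwardJump_mono hu).comp hπm).measurable)
  have hτd : ∀ s, |τ s - t₀| ≤ |s - t₀| := by
    intro s
    rcases le_or_gt t₀ s with h | h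
    · have h1 := le_lastPoint ht₀ h
      have h2 := lastPoint_le ht₀ h
      rw [hτr h, abs_of_nonneg (by linarith), abs_of_nonneg (by linarith)]
      linarith
    · have h1 := min_le_left t₀ (forwardJump T (lastPoint T s))
      have h2 : s ≤ min t₀ (forwardJump T (lastPoint T s)) :=
        le_min h.le (le_forwardJump_lastPoint hu s)
      rw [hτl h, abs_of_nonpos (by linarith), abs_of_nonpos (by linarith)]
      linarith
  obtain ⟨x, hxc, hx⟩ := exists_deviating_solution hgm hgb hτm hτd x₀
  have hint := intervalIntegrable_deviating hgm hgb hτm hτd hxc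
  have hdiff : ∀ p q, x q - x p = ∫ s in p..q, g s (x (τ s)) := by
    intro p q
    rw [hx q, hx p, add_sub_add_left_eq_sub,
      intervalIntegral.integral_interval_sub_left (hint _ _) (hint _ _)]
  refine ⟨x, by rw [hx t₀, intervalIntegral.integral_same, add_zero], fun t ht => ?_⟩
  -- Across a gap to the left of `t₀`, the backward form agrees with the forward one.
  have hback : ∀ w ∈ T, w < t₀ → Q w (x (forwardJump T w)) = P w (x w) := by
    intro w hw hwt
    have hσ := forwardJump_le hu ht₀ hwt
    have h1 : x (forwardJump T w) - x w = graininess T w • Q w (x (forwardJump T w)) := by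
      rw [hdiff, graininess, ← intervalIntegral.integral_const]
      refine integral_congr_of_Ioo (le_forwardJump hu w) fun r hr => ?_
      have hrt : r < t₀ := hr.2.trans_le hσ
      simp only [hgl hrt, hτl hrt, lastPoint_eq_of_mem_Ico hc hu hw (Ioo_subset_Ico_self hr),
        min_eq_right hσ]
    rw [← hPQ w hw, ← h1, sub_sub_cancel]
  have hf : RdBounded T fun t => P t (x t) := by
    intro t ht
    refine ⟨fun hd => ((hP t ht).1 hd).clm_apply hxc.continuousWithinAt, ?_⟩
    obtain ⟨C, hC⟩ := (hP t ht).2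
    obtain ⟨C', hC'⟩ := exists_bound_of_tendsto (hxc.continuousWithinAt (s := T) (x := t)).tendsto
    refine ⟨C * C', ?_⟩
    filter_upwards [hC, hC'] with s h1 h2
    exact ((P s).le_opNorm _).trans
      (mul_le_mul h1 h2 (norm_nonneg _) ((norm_nonneg _).trans h1))
  refine hf.hasDeltaDerivAt hc hu (fun p hp q hq hpq => ?_) ht
  rw [hdiff]
  refine integral_congr_of_Ioo hpq fun s hs => ?_
  rcases le_or_gt t₀ s with h | h
  · simp only [hgr h, hτr h]
  · have hwt : lastPoint T s < t₀ := (lastPoint_le hp hs.1.le).trans_lt h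
    simp only [hgl h, hτl h, min_eq_right (forwardJump_le hu ht₀ hwt)]
    exact hback _ (lastPoint_mem hc hne s) hwt

/-- The coefficient `A (1 + μ A)⁻¹` of the backward form of `x^Δ = A(t) x` inherits the regularity
of `A`: the inverse tends to `1` wherever the graininess tends to `0`. -/
theorem RdBounded.mul_inverse {R : Type*} [NormedRing R] [NormedAlgebra ℝ R] [CompleteSpace R]
    (hu : ∀ t, ∃ s ∈ T, t < s) {A : ℝ → R} (hA : RdBounded T A) :
    RdBounded T fun t => A t * Ring.inverse (1 + graininess T t • A t) := by
  have hinv : ∀ {l : Filter ℝ}, (∃ C, ∀ᶠ s in l, ‖A s‖ ≤ C) →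
      Tendsto (graininess T) l (𝓝 0) →
      Tendsto (fun s => Ring.inverse (1 + graininess T s • A s)) l (𝓝 1) := by
    rintro l ⟨C, hC⟩ hμ
    have h1 : Tendsto (fun s => graininess T s • A s) l (𝓝 0) := by
      refine squeeze_zero_norm' (a := fun s => ‖graininess T s‖ * C) ?_
        (by simpa using hμ.norm.mul_const C)
      filter_upwards [hC] with s hs
      rw [norm_smul]
      exact mul_le_mul_of_nonneg_left hs (norm_nonneg _)
    have h2 : Tendsto (fun s => 1 + graininess T s • A s) l (𝓝 ((1 : Rˣ) : R)) := by
      simpa using h1.const_add (1 : R)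
    have h3 := (NormedRing.inverse_continuousAt (1 : Rˣ)).tendsto.comp h2
    simpa [Function.comp_def] using h3
  intro t ht
  have hbd := (hA t ht).2
  have hcont : IsRightDense T t →
      ContinuousWithinAt (fun t => A t * Ring.inverse (1 + graininess T t • A t)) T t := by
    intro hd
    have h1 := hinv hbd (tendsto_graininess hu hd)
    have h2 : graininess T t = 0 := by rw [graininess, hd.2, sub_self]
    refine ((hA t ht).1 hd).mul ?_
    rw [ContinuousWithinAt, h2, zero_smul, add_zero, Ring.inverse_one]
    exact h1
  refine ⟨hcont, ?_⟩
  by_cases hd : IsRightDense T t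
  · exact exists_bound_of_tendsto (hcont hd)
  · obtain ⟨C, hC⟩ := hbd
    have hC' : ∀ᶠ s in 𝓝[T ∩ Iio t] t, ‖A s‖ ≤ C :=
      hC.filter_mono (nhdsWithin_mono t inter_subset_left)
    obtain ⟨C₂, hC₂⟩ := exists_bound_of_tendsto
      (hinv ⟨C, hC'⟩ (tendsto_graininess_left hu ht))
    obtain ⟨C₃, hC₃⟩ := exists_bound_sup_pure (t := t)
      (f := fun t => A t * Ring.inverse (1 + graininess T t • A t)) (l := 𝓝[T ∩ Iio t] t)
      ⟨C * C₂, by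
        filter_upwards [hC', hC₂] with s h1 h2
        exact (norm_mul_le _ _).trans
          (mul_le_mul h1 h2 (norm_nonneg _) ((norm_nonneg _).trans h1))⟩
    exact ⟨C₃, hC₃.filter_mono (nhdsWithin_le_of_not_isRightDense hu hd)⟩

theorem RdBounded.clm_comp {F : Type*} [NormedAddCommGroup F] [NormedSpace ℝ F] (L : E →L[ℝ] F)
    {f : ℝ → E} (hf : RdBounded T f) : RdBounded T fun t => L (f t) := by
  intro t ht
  refine ⟨fun hd => L.continuous.continuousAt.comp_continuousWithinAt ((hf t ht).1 hd), ?_⟩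
  obtain ⟨C, hC⟩ := (hf t ht).2
  exact ⟨‖L‖ * C, hC.mono fun s hs => L.le_opNorm_of_le hs⟩

end Coefficients

/-! ### Asymptotics of the adjoint system -/

section Asymptotics

variable {T : Set ℝ}

theorem improperDeltaIntegral_eq (hc : IsClosed T) (hu : ∀ t, ∃ s ∈ T, t < s) {E : Type*}
    [NormedAddCommGroup E] [NormedSpace ℝ E] {f F : ℝ → E} (hF : IsDeltaAntideriv T F f) {a : ℝ}
    {I : E} (h : Tendsto (fun b => F b - F a) (atTopIn T) (𝓝 I)) {t : ℝ} (ht : t ∈ T) :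
    improperDeltaIntegral T f t = I + F a - F t := by
  have hlim : Tendsto (fun b => F b - F t) (atTopIn T) (𝓝 (I + F a - F t)) := by
    refine ((h.add_const (F a)).sub_const (F t)).congr fun b => ?_
    rw [sub_add_cancel]
  have hconv : DeltaConvergent T f t := ⟨_, F, hF, hlim⟩
  rw [improperDeltaIntegral, dif_pos hconv]
  obtain ⟨F', hF', hlim'⟩ := hconv.choose_spec
  have := atTopIn_neBot hu
  refine tendsto_nhds_unique hlim' (hlim.congr' (eventually_atTopIn t fun b hb _ => ?_))
  have h0 : ∀ s ∈ T, HasDeltaDerivAt T (fun s => F s - F' s) 0 s := fun s hs => by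
    simpa using (hF s hs).sub (hF' s hs)
  have h1 := eq_of_hasDeltaDerivAt_zero hc hu h0 hb ht
  rw [sub_eq_sub_iff_add_eq_add] at h1 ⊢
  rw [h1, add_comm]

/-- If `B(t) = ∫_t^∞ A Δs` and `‖A B‖` has the convergent integral `Φ`, every solution of the adjoint
equation `W^Δ = -W^σ A` converges, and only the zero solution converges to zero.  The point is
that `Z = W (1 - B)` satisfies `Z^Δ = W^σ A B`, which is absolutely integrable. -/
theorem exists_tendsto_of_adjoint (hc : IsClosed T) (hu : ∀ t, ∃ s ∈ T, t < s) {R : Type*}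
    [NormedRing R] [NormedAlgebra ℝ R] [CompleteSpace R] {A B W : ℝ → R} {Φ : ℝ → ℝ} {J : ℝ}
    (hB : ∀ t ∈ T, HasDeltaDerivAt T B (-A t) t) (hB0 : Tendsto B (atTopIn T) (𝓝 0))
    (hΦ : ∀ t ∈ T, HasDeltaDerivAt T Φ ‖A t * B t‖ t) (hΦJ : Tendsto Φ (atTopIn T) (𝓝 J))
    (hW : ∀ t ∈ T, HasDeltaDerivAt T W (-(W (forwardJump T t) * A t)) t) :
    ∃ L, Tendsto W (atTopIn T) (𝓝 L) ∧ (L = 0 → ∃ t ∈ T, W t = 0) := by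
  have := atTopIn_neBot hu
  set Z : ℝ → R := fun t => W t - W t * B t with hZdef
  have hZ : ∀ t ∈ T, HasDeltaDerivAt T Z (W (forwardJump T t) * (A t * B t)) t := by
    intro t ht
    have h1 := (hW t ht).sub ((hW t ht).mul ht (hB t ht))
    convert h1 using 1
    simp only [neg_mul, mul_neg, mul_assoc]
    abel
  obtain ⟨t₀, ht₀, ht₀'⟩ := exists_of_eventually_atTopIn hu
    ((hB0.norm.eventually_le_const (show ‖(0 : R)‖ < 1 / 2 by simp)).and
      (Metric.tendsto_nhds.1 hΦJ (1 / 16) (by norm_num)))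
  have hinc : ∀ p ∈ T, t₀ ≤ p → ∀ q ∈ T, t₀ ≤ q → Φ q - Φ p ≤ 1 / 8 := by
    intro p hp htp q hq htq
    have h1 := (ht₀' p hp htp).2
    have h2 := (ht₀' q hq htq).2
    rw [Real.dist_eq, abs_lt] at h1 h2
    linarith [h1.1, h2.2]
  have hWZ : ∀ t ∈ T, t₀ ≤ t → ‖W t‖ ≤ 2 * ‖Z t‖ := by
    intro t ht htt
    have h1 : ‖W t * B t‖ ≤ ‖W t‖ * (1 / 2) :=
      (norm_mul_le _ _).trans (mul_le_mul_of_nonneg_left (ht₀' t ht htt).1 (norm_nonneg _))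
    have h2 : ‖W t‖ ≤ ‖Z t‖ + ‖W t * B t‖ := by
      have := norm_add_le (Z t) (W t * B t)
      rwa [hZdef, sub_add_cancel] at this
    linarith
  have hmv : ∀ M : ℝ, ∀ p ∈ T, ∀ q ∈ T, p ≤ q → (∀ t ∈ T, p ≤ t → t ≤ q → ‖W t‖ ≤ M) →
      ‖Z q - Z p‖ ≤ M * (Φ q - Φ p) := by
    intro M p hp q hq hpq hM
    rw [mul_sub]
    refine norm_sub_le_of_hasDeltaDerivAt hc hu hp hq hpq (fun t ht _ => hZ t ht)
      (fun t ht _ => (hΦ t ht).const_mul_real M) fun t ht hpt htq => ?_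
    exact (norm_mul_le _ _).trans (mul_le_mul_of_nonneg_right (hM _ (forwardJump_mem hc hu t)
      (hpt.trans (le_forwardJump hu t)) (forwardJump_le hu hq htq)) (norm_nonneg _))
  -- The maximum of `‖W‖` over `[t₀, b]` is at most `2 ‖Z t₀‖` plus a quarter of itself.
  have hbdd : ∀ b ∈ T, t₀ ≤ b → ‖W b‖ ≤ 8 / 3 * ‖Z t₀‖ := by
    intro b hb htb
    have hcomp : IsCompact (T ∩ Icc t₀ b) := isCompact_Icc.inter_left hc
    have hcont : ContinuousOn (fun t => ‖W t‖) (T ∩ Icc t₀ b) := fun t ht =>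
      (((hW t ht.1).continuousWithinAt ht.1).mono inter_subset_left).norm
    obtain ⟨m, hm, hmax⟩ := hcomp.exists_isMaxOn ⟨b, hb, htb, le_rfl⟩ hcont
    have hmax' : ∀ t ∈ T, t₀ ≤ t → t ≤ b → ‖W t‖ ≤ ‖W m‖ := fun t ht h1 h2 => hmax ⟨ht, h1, h2⟩
    have h1 := hmv ‖W m‖ t₀ ht₀ m hm.1 hm.2.1 fun t ht h1 h2 => hmax' t ht h1 (h2.trans hm.2.2)
    have h2 := mul_le_mul_of_nonneg_left (hinc t₀ ht₀ le_rfl m hm.1 hm.2.1) (norm_nonneg (W m))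
    have h3 := hWZ m hm.1 hm.2.1
    have h4 : ‖Z m‖ ≤ ‖Z t₀‖ + ‖Z m - Z t₀‖ := by
      have := norm_add_le (Z t₀) (Z m - Z t₀)
      rwa [add_sub_cancel] at this
    have h5 := hmax' b hb htb le_rfl
    linarith
  set M : ℝ := 8 / 3 * ‖Z t₀‖ with hM
  have hM0 : 0 ≤ M := by positivity
  have hZle : ∀ p ∈ T, t₀ ≤ p → ∀ q ∈ T, t₀ ≤ q → ‖Z q - Z p‖ ≤ M * |Φ q - Φ p| := by
    have key : ∀ p ∈ T, t₀ ≤ p → ∀ q ∈ T, p ≤ q → ‖Z q - Z p‖ ≤ M * |Φ q - Φ p| :=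
      fun p hp htp q hq hpq => (hmv M p hp q hq hpq fun t ht h1 _ =>
        hbdd t ht (htp.trans h1)).trans (mul_le_mul_of_nonneg_left (le_abs_self _) hM0)
    intro p hp htp q hq htq
    rcases le_total p q with h | h
    · exact key p hp htp q hq h
    · rw [norm_sub_rev, abs_sub_comm]
      exact key q hq htq p hp h
  obtain ⟨L, hL⟩ : ∃ L, Tendsto Z (atTopIn T) (𝓝 L) := by
    rw [← cauchy_map_iff_exists_tendsto, Metric.cauchy_iff]
    refine ⟨inferInstance, fun ε hε => ?_⟩
    have hη : 0 < ε / (2 * (M + 1)) := by positivity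
    obtain ⟨t₁, ht₁, ht₁'⟩ := exists_of_eventually_atTopIn hu (Metric.tendsto_nhds.1 hΦJ _ hη)
    refine ⟨Z '' {t | t ∈ T ∧ t₀ ≤ t ∧ t₁ ≤ t}, image_mem_map ?_, ?_⟩
    · exact (eventually_atTopIn t₀ fun t ht h => And.intro ht h).and
        (eventually_atTopIn t₁ fun t _ h => h) |>.mono fun t h => ⟨h.1.1, h.1.2, h.2⟩
    · rintro _ ⟨p, ⟨hp, hp0, hp1⟩, rfl⟩ _ ⟨q, ⟨hq, hq0, hq1⟩, rfl⟩
      rw [dist_eq_norm]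
      have h1 : |Φ p - Φ q| < 2 * (ε / (2 * (M + 1))) := by
        rw [← Real.dist_eq]
        linarith [dist_triangle_right (Φ p) (Φ q) J, ht₁' p hp hp1, ht₁' q hq hq1]
      have h2 : 2 * (ε / (2 * (M + 1))) = ε / (M + 1) := by field_simp
      rw [h2, lt_div_iff₀ (by positivity)] at h1
      have h3 := hZle q hq hq0 p hp hp0
      rcases (abs_nonneg (Φ p - Φ q)).eq_or_lt with h4 | h4
      · rw [← h4, mul_zero] at h3
        exact h3.trans_lt hε
      · linarith
  refine ⟨L, ?_, fun hL0 => ⟨t₀, ht₀, ?_⟩⟩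
  · have h1 : Tendsto (fun t => W t * B t) (atTopIn T) (𝓝 0) := by
      refine squeeze_zero_norm' (a := fun t => M * ‖B t‖) (eventually_atTopIn t₀ fun t ht h => ?_)
        (by simpa using hB0.norm.const_mul M)
      exact (norm_mul_le _ _).trans (mul_le_mul_of_nonneg_right (hbdd t ht h) (norm_nonneg _))
    have h2 := hL.add h1
    rw [add_zero] at h2
    exact h2.congr fun t => sub_add_cancel _ _
  · -- If `Z → 0`, the total variation bound gives `‖Z t₀‖ ≤ M / 8 = ‖Z t₀‖ / 3`.
    have h1 : ‖L - Z t₀‖ ≤ M * (1 / 8) := by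
      refine le_of_tendsto (hL.sub_const (Z t₀)).norm (eventually_atTopIn t₀ fun t ht h => ?_)
      exact (hmv M t₀ ht₀ t ht h fun s hs h1 _ => hbdd s hs h1).trans
        (mul_le_mul_of_nonneg_left (hinc t₀ ht₀ le_rfl t ht h) hM0)
    rw [hL0, zero_sub, norm_neg, hM] at h1
    have h2 := hWZ t₀ ht₀ le_rfl
    have h3 : ‖W t₀‖ ≤ 0 := by linarith [norm_nonneg (Z t₀)]
    exact norm_le_zero_iff.1 h3

end Asymptotics

/-! ### Solutions of the system and of its adjoint -/

section Banach

variable {T : Set ℝ} {R : Type*} [NormedRing R] [NormedAlgebra ℝ R] [CompleteSpace R]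

theorem exists_solution_mul (hc : IsClosed T) (hu : ∀ t, ∃ s ∈ T, t < s) {A : ℝ → R}
    (hA : RdBounded T A) (hreg : ∀ t ∈ T, IsUnit (1 + graininess T t • A t)) {t₀ : ℝ}
    (ht₀ : t₀ ∈ T) : ∃ X : ℝ → R, X t₀ = 1 ∧ ∀ t ∈ T, HasDeltaDerivAt T X (A t * X t) t := by
  refine exists_forall_hasDeltaDerivAt hc hu (hA.clm_comp (ContinuousLinearMap.mul ℝ R))
    ((hA.mul_inverse hu).clm_comp (ContinuousLinearMap.mul ℝ R)) (fun t ht v => ?_) ht₀ 1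
  simp only [ContinuousLinearMap.mul_apply']
  set U := 1 + graininess T t • A t with hU
  have h1 : U * Ring.inverse U = 1 := Ring.mul_inverse_cancel _ (hreg t ht)
  have h2 : graininess T t • (A t * Ring.inverse U) = 1 - Ring.inverse U := by
    rw [← smul_mul_assoc, ← h1, hU, add_mul, one_mul, add_sub_cancel_left]
  rw [← smul_mul_assoc, h2, sub_mul, one_mul, sub_sub_cancel, mul_assoc]

/-- The adjoint equation `Y^Δ = -Y^σ A` is solved in the form `Y^Δ = -Y A (1 + μ A)⁻¹`, whose backward
form is the adjoint equation itself. -/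
theorem exists_solution_adjoint (hc : IsClosed T) (hu : ∀ t, ∃ s ∈ T, t < s) {A : ℝ → R}
    (hA : RdBounded T A) (hreg : ∀ t ∈ T, IsUnit (1 + graininess T t • A t)) {t₀ : ℝ}
    (ht₀ : t₀ ∈ T) : ∃ Y : ℝ → R, Y t₀ = 1 ∧
      ∀ t ∈ T, HasDeltaDerivAt T Y (-(Y (forwardJump T t) * A t)) t := by
  have hUinv : ∀ t ∈ T, Ring.inverse (1 + graininess T t • A t) *
      (1 + graininess T t • A t) = 1 := fun t ht => Ring.inverse_mul_cancel _ (hreg t ht)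
  obtain ⟨Y, hY0, hY⟩ := exists_forall_hasDeltaDerivAt hc hu
    ((hA.mul_inverse hu).clm_comp (-(ContinuousLinearMap.mul ℝ R).flip))
    (hA.clm_comp (-(ContinuousLinearMap.mul ℝ R).flip)) (fun t ht v => by
      simp only [neg_apply, ContinuousLinearMap.flip_apply,
        ContinuousLinearMap.mul_apply']
      have h1 : v - graininess T t • -(v * A t) = v * (1 + graininess T t • A t) := by
        rw [smul_neg, sub_neg_eq_add, mul_add, mul_one, mul_smul_comm]
      have h2 : (1 + graininess T t • A t) * A t = A t * (1 + graininess T t • A t) := by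
        rw [add_mul, mul_add, one_mul, mul_one, smul_mul_assoc, mul_smul_comm]
      rw [h1, mul_assoc, ← mul_assoc _ (A t), h2, mul_assoc,
        Ring.mul_inverse_cancel _ (hreg t ht), mul_one]) ht₀ (1 : R)
  refine ⟨Y, hY0, fun t ht => ?_⟩
  have h := hY t ht
  have hj := h.forwardJump_eq ht
  simp only [neg_apply, ContinuousLinearMap.flip_apply,
    ContinuousLinearMap.mul_apply'] at h hj
  set U := 1 + graininess T t • A t with hU
  have h1 : Ring.inverse U * U = 1 := hUinv t ht
  have h2 : U * Ring.inverse U = 1 := Ring.mul_inverse_cancel _ (hreg t ht)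
  have h3 : Y (forwardJump T t) = Y t * Ring.inverse U := by
    have h4 : graininess T t • (A t * Ring.inverse U) = 1 - Ring.inverse U := by
      rw [← smul_mul_assoc, ← h2, hU, add_mul, one_mul, add_sub_cancel_left]
    rw [hj, smul_neg, ← mul_smul_comm, h4, mul_sub, mul_one]
    abel
  have h5 : Ring.inverse U * A t = A t * Ring.inverse U := by
    have h6 : A t * U = U * A t := by
      rw [hU, add_mul, mul_add, one_mul, mul_one, smul_mul_assoc, mul_smul_comm]
    calc Ring.inverse U * A t = Ring.inverse U * (A t * U) * Ring.inverse U := by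
          rw [mul_assoc, mul_assoc, h2, mul_one]
      _ = A t * Ring.inverse U := by rw [h6, ← mul_assoc, h1, one_mul]
  rw [h3, mul_assoc, h5]
  exact h

end Banach

/-! ### Matrix systems -/

section MatrixSystems

attribute [local instance] Matrix.linftyOpNormedRing Matrix.linftyOpNormedAlgebra

variable {𝕜 : Type*} [RCLike 𝕜] {n : ℕ} {T : Set ℝ}

theorem isBoundedBilinearMap_mulVec :
    IsBoundedBilinearMap ℝ fun p : Matrix (Fin n) (Fin n) 𝕜 × (Fin n → 𝕜) => p.1.mulVec p.2 where
  add_left _ _ _ := Matrix.add_mulVec _ _ _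
  smul_left _ _ _ := Matrix.smul_mulVec _ _ _
  add_right _ _ _ := Matrix.mulVec_add _ _ _
  smul_right _ _ _ := Matrix.mulVec_smul _ _ _
  bound := ⟨1, one_pos, fun M v => by
    rw [one_mul]; exact Matrix.linfty_opNorm_mulVec M v⟩

/-- The limit of an invertible solution `Y` of the adjoint system is invertible: otherwise
`V L = 0` for some `V ≠ 0`, and the solution `V Y` of the same system tends to zero. -/
theorem exists_tendsto_isUnit_of_adjoint (hc : IsClosed T) (hu : ∀ t, ∃ s ∈ T, t < s)
    {A B Y : ℝ → Matrix (Fin n) (Fin n) 𝕜} {Φ : ℝ → ℝ} {J : ℝ}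
    (hB : ∀ t ∈ T, HasDeltaDerivAt T B (-A t) t) (hB0 : Tendsto B (atTopIn T) (𝓝 0))
    (hΦ : ∀ t ∈ T, HasDeltaDerivAt T Φ ‖A t * B t‖ t) (hΦJ : Tendsto Φ (atTopIn T) (𝓝 J))
    (hY : ∀ t ∈ T, HasDeltaDerivAt T Y (-(Y (forwardJump T t) * A t)) t)
    (hYu : ∀ t ∈ T, IsUnit (Y t)) :
    ∃ L, Tendsto Y (atTopIn T) (𝓝 L) ∧ IsUnit L := by
  obtain ⟨L, hL, -⟩ := exists_tendsto_of_adjoint hc hu hB hB0 hΦ hΦJ hY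
  refine ⟨L, hL, ?_⟩
  by_contra hLu
  rw [Matrix.isUnit_iff_isUnit_det, isUnit_iff_ne_zero, not_not] at hLu
  obtain ⟨v, hv, hvL⟩ := Matrix.exists_vecMul_eq_zero_iff.2 hLu
  set V : Matrix (Fin n) (Fin n) 𝕜 := Matrix.of fun _ => v with hV
  have hVL : V * L = 0 := by
    ext i j
    exact congrFun hvL j
  have hVY : ∀ t ∈ T, HasDeltaDerivAt T (fun s => V * Y s)
      (-((V * Y (forwardJump T t)) * A t)) t := fun t ht => by
    simpa [mul_assoc] using (HasDeltaDerivAt.const V t).mul ht (hY t ht)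
  obtain ⟨L', hL', hzero⟩ := exists_tendsto_of_adjoint hc hu hB hB0 hΦ hΦJ hVY
  have := atTopIn_neBot hu
  have hlim : Tendsto (fun s => V * Y s) (atTopIn T) (𝓝 (V * L)) := hL.const_mul V
  obtain ⟨t, ht, hVt⟩ := hzero ((tendsto_nhds_unique hL' hlim).trans hVL)
  have hV0 : V = 0 := (hYu t ht).mul_left_eq_zero.1 hVt
  obtain ⟨i, -⟩ := Function.ne_iff.1 hv
  exact hv (funext fun j => congrFun (congrFun hV0 i) j)

theorem adjoint_mul_eq (hc : IsClosed T) (hu : ∀ t, ∃ s ∈ T, t < s)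
    {A Y X : ℝ → Matrix (Fin n) (Fin n) 𝕜}
    (hY : ∀ t ∈ T, HasDeltaDerivAt T Y (-(Y (forwardJump T t) * A t)) t)
    (hX : ∀ t ∈ T, HasDeltaDerivAt T X (A t * X t) t) {s t : ℝ} (hs : s ∈ T) (ht : t ∈ T) :
    Y t * X t = Y s * X s := by
  refine eq_of_hasDeltaDerivAt_zero hc hu (f := fun r => Y r * X r) (fun r hr => ?_) ht hs
  simpa [mul_assoc] using (hY r hr).mul hr (hX r hr)

/-- Under the hypotheses of the theorem, the adjoint system has a solution `Y` that is inverse to a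
matrix solution `X` of the system and has an invertible limit. -/
theorem exists_adjoint_tendsto_isUnit (hc : IsClosed T) (hu : ∀ t, ∃ s ∈ T, t < s)
    {A : ℝ → Matrix (Fin n) (Fin n) 𝕜} (hrd : RdContinuous T A) (hreg : IsRegressive T A)
    {a : ℝ} (ha : a ∈ T) (hconv : DeltaConvergent T A a)
    (habs : DeltaAbsConvergent T (fun t => A t * improperDeltaIntegral T A t) a) :
    ∃ (X Y : ℝ → Matrix (Fin n) (Fin n) 𝕜) (L : Matrix (Fin n) (Fin n) 𝕜),
      (∀ t ∈ T, HasDeltaDerivAt T X (A t * X t) t) ∧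
      (∀ t ∈ T, HasDeltaDerivAt T Y (-(Y (forwardJump T t) * A t)) t) ∧
      (∀ t ∈ T, Y t * X t = 1) ∧ Tendsto Y (atTopIn T) (𝓝 L) ∧ IsUnit L := by
  have hA : RdBounded T A := hrd.rdBounded hu
  obtain ⟨X, hX0, hX⟩ := exists_solution_mul hc hu hA hreg ha
  obtain ⟨Y, hY0, hY⟩ := exists_solution_adjoint hc hu hA hreg ha
  have hYX : ∀ t ∈ T, Y t * X t = 1 := fun t ht => by
    rw [adjoint_mul_eq hc hu hY hX ha ht, hX0, hY0, one_mul]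
  obtain ⟨I, F, hF, hFI⟩ := hconv
  obtain ⟨J, Φ, hΦ, hΦJ⟩ := habs
  have hBeq : ∀ t ∈ T, improperDeltaIntegral T A t = I + F a - F t := fun t ht =>
    improperDeltaIntegral_eq hc hu hF hFI ht
  have hB : ∀ t ∈ T, HasDeltaDerivAt T (fun t => I + F a - F t) (-A t) t := fun t ht =>
    (hF t ht).const_sub _
  have hB0 : Tendsto (fun t => I + F a - F t) (atTopIn T) (𝓝 0) := by
    have h := hFI.const_sub I
    rw [sub_self] at h
    exact h.congr fun t => by abel
  have hΦ' : ∀ t ∈ T, HasDeltaDerivAt T Φ ‖A t * (I + F a - F t)‖ t := fun t ht => by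
    rw [← hBeq t ht]
    exact hΦ t ht
  have hΦJ' : Tendsto Φ (atTopIn T) (𝓝 (J + Φ a)) :=
    (hΦJ.add_const (Φ a)).congr fun t => sub_add_cancel _ _
  obtain ⟨L, hL, hLu⟩ := exists_tendsto_isUnit_of_adjoint hc hu hB hB0 hΦ' hΦJ' hY
    fun t ht => IsUnit.of_mul_eq_one _ (hYX t ht)
  exact ⟨X, Y, L, hX, hY, hYX, hL, hLu⟩

theorem adjoint_mulVec_eq (hc : IsClosed T) (hu : ∀ t, ∃ s ∈ T, t < s)
    {A Y : ℝ → Matrix (Fin n) (Fin n) 𝕜} {x : ℝ → Fin n → 𝕜}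
    (hY : ∀ t ∈ T, HasDeltaDerivAt T Y (-(Y (forwardJump T t) * A t)) t)
    (hx : IsSolution T A x) {s t : ℝ} (hs : s ∈ T) (ht : t ∈ T) :
    (Y t).mulVec (x t) = (Y s).mulVec (x s) := by
  refine eq_of_hasDeltaDerivAt_zero hc hu (f := fun r => (Y r).mulVec (x r)) (fun r hr => ?_) ht hs
  have h := (hY r hr).bilinear isBoundedBilinearMap_mulVec hr (hx r hr)
  simpa only [Matrix.neg_mulVec, Matrix.mulVec_mulVec, neg_add_cancel] using h

theorem isSolution_mulVec {A X : ℝ → Matrix (Fin n) (Fin n) 𝕜}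
    (hX : ∀ t ∈ T, HasDeltaDerivAt T X (A t * X t) t) (c : Fin n → 𝕜) :
    IsSolution T A fun t => (X t).mulVec c := fun t ht => by
  have h := (hX t ht).bilinear isBoundedBilinearMap_mulVec ht (HasDeltaDerivAt.const c t)
  simpa only [Matrix.mulVec_zero, add_zero, ← Matrix.mulVec_mulVec] using h

theorem tendsto_matrix_inv {l : Filter ℝ} {Y : ℝ → Matrix (Fin n) (Fin n) 𝕜}
    {L : Matrix (Fin n) (Fin n) 𝕜} (hL : Tendsto Y l (𝓝 L)) (hLu : IsUnit L) :
    Tendsto (fun t => (Y t)⁻¹) l (𝓝 L⁻¹) := by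
  obtain ⟨u, rfl⟩ := hLu
  have h := (NormedRing.inverse_continuousAt u).tendsto.comp hL
  simp only [Function.comp_def, ← Matrix.nonsing_inv_eq_ringInverse] at h
  exact h

end MatrixSystems

theorem theorem2 {𝕜 : Type*} [RCLike 𝕜] (n : ℕ) (T : Set ℝ) (hT : IsTimeScale T)
    (hsup : ¬ BddAbove T) (A : ℝ → Matrix (Fin n) (Fin n) 𝕜)
    (hrd : RdContinuous T A) (hreg : IsRegressive T A) (a : ℝ) (ha : a ∈ T)
    (hconv : DeltaConvergent T A a)
    (habs : DeltaAbsConvergent T (fun t => A t * improperDeltaIntegral T A t) a) :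
    IsClassS T A ∧
      ∀ X : ℝ → Matrix (Fin n) (Fin n) 𝕜, IsFundamentalMatrix T A X →
        ∃ L : Matrix (Fin n) (Fin n) 𝕜, Tendsto X (atTopIn T) (𝓝 L) ∧ IsUnit L := by
  have hc := hT.2
  have hu : ∀ t, ∃ s ∈ T, t < s := not_bddAbove_iff.1 hsup
  obtain ⟨X, Y, L, hX, hY, hYX, hL, hLu⟩ :=
    exists_adjoint_tendsto_isUnit hc hu hrd hreg ha hconv habs
  have hYu : ∀ t ∈ T, IsUnit (Y t).det := fun t ht =>
    (Matrix.isUnit_iff_isUnit_det _).1 (IsUnit.of_mul_eq_one _ (hYX t ht))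
  have hinv := tendsto_matrix_inv hL hLu
  -- Every solution is `Y⁻¹` times a constant vector.
  have hlim : ∀ x, IsSolution T A x →
      Tendsto x (atTopIn T) (𝓝 (L⁻¹.mulVec ((Y a).mulVec (x a)))) := by
    intro x hx
    have h1 : Tendsto (fun t => (Y t)⁻¹.mulVec ((Y a).mulVec (x a))) (atTopIn T)
        (𝓝 (L⁻¹.mulVec ((Y a).mulVec (x a)))) :=
      ((continuous_id.matrix_mulVec continuous_const).tendsto L⁻¹).comp hinv
    refine h1.congr' (eventually_atTopIn a fun t ht _ => ?_)
    rw [← adjoint_mulVec_eq hc hu hY hx ha ht, Matrix.mulVec_mulVec,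
      Matrix.nonsing_inv_mul _ (hYu t ht), Matrix.one_mulVec]
  refine ⟨⟨fun x hx => ⟨_, hlim x hx⟩, fun c => ?_⟩, fun X' hX' => ?_⟩
  · -- The solution with `Y x = L c` tends to `L⁻¹ (L c) = c`.
    refine ⟨fun t => (X t).mulVec (L.mulVec c), isSolution_mulVec hX _, ?_⟩
    have h1 := hlim _ (isSolution_mulVec hX (L.mulVec c))
    rwa [Matrix.mulVec_mulVec _ (Y a), hYX a ha, Matrix.one_mulVec, Matrix.mulVec_mulVec,
      Matrix.nonsing_inv_mul _ ((Matrix.isUnit_iff_isUnit_det _).1 hLu), Matrix.one_mulVec] at h1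
  · refine ⟨L⁻¹ * (Y a * X' a), ?_, ?_⟩
    · have h1 : Tendsto (fun t => (Y t)⁻¹ * (Y a * X' a)) (atTopIn T)
          (𝓝 (L⁻¹ * (Y a * X' a))) :=
        ((continuous_id.matrix_mul continuous_const).tendsto L⁻¹).comp hinv
      refine h1.congr' (eventually_atTopIn a fun t ht _ => ?_)
      rw [← adjoint_mul_eq hc hu hY (fun s hs => (hX' s hs).1) ha ht, ← mul_assoc,
        Matrix.nonsing_inv_mul _ (hYu t ht), one_mul]
    · exact ((Matrix.isUnit_nonsing_inv_iff).2 hLu).mul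
        (((Matrix.isUnit_iff_isUnit_det _).2 (hYu a ha)).mul (hX' a ha).2)
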